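/- Theorem 3. Let $0<H<1$, $\sigma>0$, $0\le q<p$, and let $\alpha_0,\dots,\alpha_p$, $\beta_1,\dots,\beta_q$ be real with $\alpha_1\ne 0$ and (if $q\geq 1$) $\beta_q\neq 0$. Let $A$ be the $p\times p$ companion matrix with ones on the superdiagonal, last row $(\alpha_1,\dots,\alpha_p)$ and zeros elsewhere; let $\delta_p=(0,\dots,0,1)'$, $\beta=(1,\beta_1,\dots,\beta_{p-1})'$ with $\beta_j=0$ for $j>q$, $\alpha(z)=z^p-\alpha_pz^{p-1}-\dots-\alpha_1$ and $\beta(z)=1+\beta_1z+\dots+\beta_qz^q$. Assume that all eigenvalues of $A$ have negative real parts. Let $\{B^H_t\}_{t\in\mathbb R}$ be a standard fractional Brownian motion, that is, a centred Gaussian process with $B_0^H=0$ and $E(B^H_tB^H_s)=\frac12\{|t|^{2H}+|s|^{2H}-|t-s|^{2H}\}$ for $s,t\in\mathbb R$. Say that a square-integrable real process $\{Y_t\}_{t\in\mathbb R}$ with constant mean has spectral density $f$ if $f\ge0$ is integrable on $\mathbb R$ and $\operatorname{cov}(Y_{t+h},Y_t)=\int_{-\infty}^{\infty}e^{ihw}f(w)\,dw$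 for all $t,h\in\mathbb R$. Put $$f_Y(w)=\frac{\sigma^2}{2\pi}\Gamma(2H+1)\sin(\pi H)|w|^{1-2H}\frac{|\beta(iw)|^2}{|\alpha(iw)|^2}.$$ (a) For every $t\in\mathbb R$ the integral in $$Y_t=-\frac{\alpha_0}{\alpha_1}+\sigma\int_{-\infty}^t\beta' e^{A(t-u)}\delta_p\,dB_u^H$$ exists (as the $L^2$ limit, when $a\to-\infty$, of the integrals over $[a,t]$, each of which is the $L^2$ limit of Riemann sums over tagged partitions with mesh tending to zero), and this stationary CARFIMA$(p,H,q)$ process $\{Y_t\}_{t\in\mathbb R}$ has spectral density $f_Y$. (b) More generally, if $\{X_t\}_{t\in\mathbb R}$ is any strictly stationary process in $\mathbb R^p$ with almost surely continuous paths that solves $dX_t=(AX_t+\alpha_0\delta_p)\,dt+\sigma\delta_p\,dB^H_t$ on $\mathbb R$, that is, almost surely $X_t-X_s=\int_s^t(AX_u+\alpha_0\delta_p)\,du+\sigma\delta_p(B^H_t-B^H_s)$ for all $s\le t$, then $Y_t=\beta'X_t$ has spectral density $f_Y$. (c) For every $w$ (for $w\neq0$ when $H>1/2$), $f_Y(w)$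 is the product of the ARMA spectral density $\frac{\sigma^2}{2\pi}\frac{|\beta(iw)|^2}{|\alpha(iw)|^2}$ and the fractional-noise factor $\Gamma(2H+1)\sin(\pi H)|w|^{1-2H}$; in particular $f_Y(0)=0$ when $H<1/2$. -/

import Mathlib

open MeasureTheory ProbabilityTheory Filter Topology Matrix

noncomputable section

namespace Carfima

variable {Ω : Type*} [MeasurableSpace Ω]

/-- Standard two-sided fractional Brownian motion with Hurst parameter `H`: a Gaussian process
started at `0`, centred, with covariance kernel `(|t|^{2H} + |s|^{2H} - |t - s|^{2H}) / 2`. -/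
structure IsFBM (P : Measure Ω) (H : ℝ) (B : ℝ → Ω → ℝ) : Prop where
  gaussian : IsGaussianProcess B P
  zero : ∀ᵐ ω ∂P, B 0 ω = 0
  mean : ∀ t, ∫ ω, B t ω ∂P = 0
  kernel : ∀ s t, ∫ ω, B t ω * B s ω ∂P
    = (|t| ^ (2 * H) + |s| ^ (2 * H) - |t - s| ^ (2 * H)) / 2

/-- `J` is the stochastic integral `∫_a^b f(u) dB_u` of the deterministic function `f`, `a ≤ b`:
the limit in `L²(P)` of the Riemann sums over tagged partitions `a = u 0 ≤ ⋯ ≤ u n = b` with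
tags `τ k ∈ [u k, u (k + 1)]`, as the mesh tends to zero. -/
def IsIntegral (P : Measure Ω) (B : ℝ → Ω → ℝ) (f : ℝ → ℝ) (a b : ℝ) (J : Ω → ℝ) : Prop :=
  MemLp J 2 P ∧ ∀ ε : ℝ, 0 < ε → ∃ δ : ℝ, 0 < δ ∧
    ∀ (n : ℕ) (u τ : ℕ → ℝ), u 0 = a → u n = b →
      (∀ k < n, u k ≤ τ k ∧ τ k ≤ u (k + 1) ∧ u (k + 1) - u k ≤ δ) →
      eLpNorm (fun ω => (∑ k ∈ Finset.range n, f (τ k) * (B (u (k + 1)) ω - B (u k) ω)) - J ω) 2 P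
        ≤ ENNReal.ofReal ε

/-- `J` is the stochastic integral `∫_{-∞}^t f(u) dB_u`: the limit in `L²(P)` of
`∫_a^t f(u) dB_u` as `a → -∞`. -/
def IsIntegralIic (P : Measure Ω) (B : ℝ → Ω → ℝ) (f : ℝ → ℝ) (t : ℝ) (J : Ω → ℝ) : Prop :=
  MemLp J 2 P ∧ ∃ K : ℝ → Ω → ℝ, (∀ a < t, IsIntegral P B f a t (K a)) ∧
    Tendsto (fun a => eLpNorm (fun ω => K a ω - J ω) 2 P) atBot (𝓝 0)

/-- The `p × p` companion matrix: ones on the superdiagonal, last row `α 1, …, α p`. -/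
def companion (p : ℕ) (α : ℕ → ℝ) : Matrix (Fin p) (Fin p) ℝ := fun i j =>
  if (i : ℕ) + 1 = p then α (j + 1) else if (j : ℕ) = i + 1 then 1 else 0

/-- The last standard basis vector `(0, …, 0, 1)'` of `ℝ^p`. -/
def deltaVec (p : ℕ) : Fin p → ℝ := fun i => if (i : ℕ) + 1 = p then 1 else 0

/-- The vector `(1, β 1, …, β q, 0, …, 0)'` of `ℝ^p`. -/
def betaVec (p q : ℕ) (β : ℕ → ℝ) : Fin p → ℝ := fun i =>
  if (i : ℕ) = 0 then 1 else if (i : ℕ) ≤ q then β i else 0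

/-- `α(z) = z^p - α_p z^{p-1} - ⋯ - α_1`. -/
def alphaPoly (p : ℕ) (α : ℕ → ℝ) (z : ℂ) : ℂ :=
  z ^ p - ∑ j ∈ Finset.Icc 1 p, (α j : ℂ) * z ^ (j - 1)

/-- `β(z) = 1 + β_1 z + ⋯ + β_q z^q`. -/
def betaPoly (q : ℕ) (β : ℕ → ℝ) (z : ℂ) : ℂ :=
  1 + ∑ j ∈ Finset.Icc 1 q, (β j : ℂ) * z ^ j

/-- All complex eigenvalues of the real matrix `A` have negative real parts. -/
def IsStable {p : ℕ} (A : Matrix (Fin p) (Fin p) ℝ) : Prop :=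
  ∀ z : ℂ, Module.End.HasEigenvalue (Matrix.toLin' (A.map (fun x : ℝ => (x : ℂ)))) z → z.re < 0

/-- Strict stationarity: the finite-dimensional distributions are invariant under time shifts. -/
def IsStrictlyStationary {E : Type*} [MeasurableSpace E] (P : Measure Ω) (X : ℝ → Ω → E) : Prop :=
  ∀ (I : Finset ℝ) (h : ℝ),
    IdentDistrib (fun ω (t : I) => X (t + h) ω) (fun ω (t : I) => X t ω) P P

/-- `X` solves the state equation `dX_t = (A X_t + α_0 δ_p) dt + σ δ_p dB_t` on the whole real
line, read as an integral equation: almost every path is continuous and satisfies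
`X_t - X_s = ∫_s^t (A X_u + α_0 δ_p) du + σ (B_t - B_s) δ_p` for all `s ≤ t`. -/
def IsStateSolution (P : Measure Ω) (B : ℝ → Ω → ℝ) (p : ℕ) (α : ℕ → ℝ) (σ : ℝ)
    (X : ℝ → Ω → Fin p → ℝ) : Prop :=
  ∀ᵐ ω ∂P, Continuous (fun t => X t ω) ∧ ∀ s t : ℝ, s ≤ t →
    X t ω - X s ω = (∫ u in s..t, (companion p α *ᵥ X u ω + α 0 • deltaVec p))
      + (σ * (B t ω - B s ω)) • deltaVec p

/-- `Y` is the moving-average process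
`Y_t = -α_0 / α_1 + σ ∫_{-∞}^t β' exp(A (t - u)) δ_p dB_u`, `t ∈ ℝ`. -/
def IsMovingAverage (P : Measure Ω) (B : ℝ → Ω → ℝ) (p q : ℕ) (α β : ℕ → ℝ) (σ : ℝ)
    (Y : ℝ → Ω → ℝ) : Prop :=
  ∀ t : ℝ, ∃ J : Ω → ℝ,
    IsIntegralIic P B
      (fun u => betaVec p q β ⬝ᵥ (NormedSpace.exp ((t - u) • companion p α) *ᵥ deltaVec p)) t J ∧
    ∀ᵐ ω ∂P, Y t ω = -(α 0 / α 1) + σ * J ω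

/-- The real process `Y` is covariance-stationary with spectral density `f`: `f` is nonnegative
and integrable, and `cov(Y_{t+h}, Y_t) = ∫ e^{ihw} f(w) dw` for all real `t`, `h`. -/
structure HasSpectralDensity (P : Measure Ω) (Y : ℝ → Ω → ℝ) (f : ℝ → ℝ) : Prop where
  memLp : ∀ t, MemLp (Y t) 2 P
  mean_eq : ∀ s t, ∫ ω, Y s ω ∂P = ∫ ω, Y t ω ∂P
  nonneg : ∀ w, 0 ≤ f w
  integrable : Integrable f
  cov_eq : ∀ t h : ℝ, ((cov[Y (t + h), Y t; P] : ℝ) : ℂ)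
    = ∫ w : ℝ, Complex.exp (Complex.I * (h : ℂ) * (w : ℂ)) * (f w : ℂ)

/-- The spectral density of the continuous-time ARMA process (the case of Brownian noise). -/
def armaDensity (p q : ℕ) (α β : ℕ → ℝ) (σ w : ℝ) : ℝ :=
  σ ^ 2 / (2 * Real.pi) *
    (‖betaPoly q β (Complex.I * (w : ℂ))‖ ^ 2 / ‖alphaPoly p α (Complex.I * (w : ℂ))‖ ^ 2)

/-- The CARFIMA spectral density. -/
def carfimaDensity (p q : ℕ) (α β : ℕ → ℝ) (H σ w : ℝ) : ℝ :=
  σ ^ 2 / (2 * Real.pi) * Real.Gamma (2 * H + 1) * Real.sin (Real.pi * H) * |w| ^ (1 - 2 * H) *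
    (‖betaPoly q β (Complex.I * (w : ℂ))‖ ^ 2 / ‖alphaPoly p α (Complex.I * (w : ℂ))‖ ^ 2)

end Carfima

end

/-!
The increments of fractional Brownian motion have a spectral measure, with density proportional to
`|w|^(-1-2H)`: the covariance of `B_t - B_s` and `B_v - B_u` is the integral of
`(e^{itw} - e^{isw}) (e^{-ivw} - e^{-iuw})` against it. Integration by parts turns the stochastic
integral `∫_{-∞}^t g(t-u) dB_u` into the average `∫_0^∞ g'(r) (B_{t-r} - B_t) dr` of increments, a
linear filter whose transfer function is that of `g` multiplied by `iw`. For
`g(r) = β' exp(rA) δ_p` the transfer function of `g` is the resolvent `β' (iw - A)⁻¹ δ_p`, which is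
`β(iw)/α(iw)` since `A` is a companion matrix. The variation of constants formula expresses a
stationary solution as this integral over `[s, t]` plus a term depending on `X_s`; the law of `X_s`
does not depend on `s`, so stability makes that term vanish in probability as `s → -∞`.
-/

noncomputable section

namespace Carfima

section OneSubCos

open Set Real

theorem lintegral_ofReal_of_integral_eq {X : Type*} [MeasurableSpace X] {μ : Measure X}
    {f : X → ℝ} {V : ℝ} (hV : V ≠ 0) (hf : 0 ≤ᵐ[μ] f) (h : ∫ x, f x ∂μ = V) :
    ∫⁻ x, ENNReal.ofReal (f x) ∂μ = ENNReal.ofReal V := by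
  rw [← h, ofReal_integral_eq_lintegral_ofReal (.of_integral_ne_zero (h.trans_ne hV)) hf]

theorem integral_one_sub_cos_mul_exp {s : ℝ} (hs : 0 < s) :
    ∫ x in Ioi (0 : ℝ), (1 - cos x) * exp (-(s * x)) = 1 / (s * (1 + s ^ 2)) := by
  have hexp : Tendsto (fun x : ℝ => exp (-(s * x))) atTop (𝓝 0) :=
    tendsto_exp_neg_atTop_nhds_zero.comp (tendsto_id.const_mul_atTop hs)
  rw [integral_Ioi_of_hasDerivAt_of_nonneg' (l := 0)
    (g := fun x => exp (-(s * x)) * (-(1 / s) - (sin x - s * cos x) / (1 + s ^ 2)))]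
  · simp only [mul_zero, neg_zero, exp_zero, sin_zero, cos_zero]
    field_simp
    ring
  · intro x _
    have h_exp : HasDerivAt (fun x : ℝ => exp (-(s * x))) (exp (-(s * x)) * (-(s * 1))) x :=
      (((hasDerivAt_id x).const_mul s).neg).exp
    have h_trig : HasDerivAt (fun x : ℝ => -(1 / s) - (sin x - s * cos x) / (1 + s ^ 2))
        (-((cos x - s * (-sin x)) / (1 + s ^ 2))) x :=
      ((((hasDerivAt_sin x).sub ((hasDerivAt_cos x).const_mul s)).div_const _)).const_sub _
    refine (h_exp.mul h_trig).congr_deriv ?_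
    field_simp
    ring
  · exact fun x _ => mul_nonneg (by linarith [cos_le_one x]) (exp_pos _).le
  · refine hexp.zero_mul_isBoundedUnder_le
      (isBoundedUnder_of ⟨1 / s + (1 + s) / (1 + s ^ 2), fun x => ?_⟩)
    have h_trig : |sin x - s * cos x| ≤ 1 + s := by
      rw [abs_le]
      constructor <;> nlinarith [sin_le_one x, cos_le_one x, neg_one_le_sin x, neg_one_le_cos x]
    simp only [Function.comp, norm_eq_abs]
    refine (abs_sub _ _).trans ?_
    rw [abs_neg, abs_of_pos (by positivity : 0 < 1 / s), abs_div,
      abs_of_pos (by positivity : 0 < 1 + s ^ 2)]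
    gcongr

theorem lintegral_ofReal_rpow_mul_exp {a x : ℝ} (ha : 0 < a) (hx : 0 < x) :
    ∫⁻ s in Ioi (0 : ℝ), ENNReal.ofReal (s ^ (a - 1) * exp (-(x * s)))
      = ENNReal.ofReal (x ^ (-a) * Gamma a) := by
  refine lintegral_ofReal_of_integral_eq (by positivity) ?_ ?_
  · filter_upwards [ae_restrict_mem measurableSet_Ioi] with s hs
    exact mul_nonneg (rpow_nonneg (le_of_lt hs) _) (exp_pos _).le
  · rw [integral_rpow_mul_exp_neg_mul_Ioi ha hx, one_div, inv_rpow hx.le, rpow_neg hx.le]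

theorem lintegral_ofReal_exp_neg_mul {c : ℝ} (hc : 0 < c) :
    ∫⁻ r in Ioi (0 : ℝ), ENNReal.ofReal (exp (-(c * r))) = ENNReal.ofReal c⁻¹ := by
  simpa [rpow_neg_one] using lintegral_ofReal_rpow_mul_exp one_pos hc

theorem lintegral_ofReal_rpow_mul_exp_neg_mul_sq {a r : ℝ} (ha : 0 < a) (hr : 0 < r) :
    ∫⁻ s in Ioi (0 : ℝ), ENNReal.ofReal (s ^ (2 * a - 1) * exp (-(r * s ^ 2)))
      = ENNReal.ofReal (r ^ (-a) * (Gamma a / 2)) := by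
  refine lintegral_ofReal_of_integral_eq (by positivity) ?_ ?_
  · filter_upwards [ae_restrict_mem measurableSet_Ioi] with s hs
    exact mul_nonneg (rpow_nonneg (le_of_lt hs) _) (exp_pos _).le
  · have h := integral_rpow_mul_exp_neg_mul_rpow (p := 2) (q := 2 * a - 1) two_pos
      (by linarith) hr
    simp only [rpow_two, neg_mul] at h
    rw [h, show -(2 * a - 1 + 1) / 2 = -a by ring, show (2 * a - 1 + 1) / 2 = a by ring]
    ring

theorem lintegral_rpow_div_one_add_sq {a : ℝ} (ha0 : 0 < a) (ha1 : a < 1) :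
    ∫⁻ s in Ioi (0 : ℝ), ENNReal.ofReal (s ^ (2 * a - 1) / (1 + s ^ 2))
      = ENNReal.ofReal (π / (2 * sin (π * a))) := by
  calc ∫⁻ s in Ioi (0 : ℝ), ENNReal.ofReal (s ^ (2 * a - 1) / (1 + s ^ 2))
      = ∫⁻ s in Ioi (0 : ℝ), ∫⁻ r in Ioi (0 : ℝ),
          ENNReal.ofReal (s ^ (2 * a - 1) * exp (-((1 + s ^ 2) * r))) := by
        refine setLIntegral_congr_fun measurableSet_Ioi fun s hs => ?_
        have hpow : 0 ≤ s ^ (2 * a - 1) := rpow_nonneg (le_of_lt hs) _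
        simp_rw [ENNReal.ofReal_mul hpow]
        rw [lintegral_const_mul' _ _ ENNReal.ofReal_ne_top,
          lintegral_ofReal_exp_neg_mul (by positivity), ← ENNReal.ofReal_mul hpow, div_eq_mul_inv]
    _ = ∫⁻ r in Ioi (0 : ℝ), ∫⁻ s in Ioi (0 : ℝ),
          ENNReal.ofReal (exp (-r) * (s ^ (2 * a - 1) * exp (-(r * s ^ 2)))) := by
        rw [lintegral_lintegral_swap (by fun_prop)]
        congr! 5 with r s
        rw [mul_left_comm, ← exp_add]
        ring_nf
    _ = ∫⁻ r in Ioi (0 : ℝ), ENNReal.ofReal (Gamma a / 2 * (r ^ (1 - a - 1) * exp (-(1 * r)))) := by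
        refine setLIntegral_congr_fun measurableSet_Ioi fun r hr => ?_
        simp_rw [ENNReal.ofReal_mul (exp_pos (-r)).le]
        rw [lintegral_const_mul' _ _ ENNReal.ofReal_ne_top,
          lintegral_ofReal_rpow_mul_exp_neg_mul_sq ha0 hr, ← ENNReal.ofReal_mul (exp_pos _).le,
          one_mul, sub_sub_cancel_left]
        ring_nf
    _ = ENNReal.ofReal (π / (2 * sin (π * a))) := by
        simp_rw [ENNReal.ofReal_mul (by positivity : 0 ≤ Gamma a / 2)]
        rw [lintegral_const_mul' _ _ ENNReal.ofReal_ne_top,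
          lintegral_ofReal_rpow_mul_exp (by linarith) one_pos, ← ENNReal.ofReal_mul (by positivity),
          one_rpow, one_mul, div_mul_eq_mul_div, Gamma_mul_Gamma_one_sub, div_div, mul_comm 2]

theorem sin_pi_mul_pos {H : ℝ} (h0 : 0 < H) (h1 : H < 1) : 0 < sin (π * H) :=
  sin_pos_of_pos_of_lt_pi (by positivity) (by nlinarith [pi_pos])

theorem lintegral_one_sub_cos_mul_rpow {H : ℝ} (h0 : 0 < H) (h1 : H < 1) :
    ∫⁻ x in Ioi (0 : ℝ), ENNReal.ofReal ((1 - cos x) * x ^ (-1 - 2 * H))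
      = ENNReal.ofReal (π / (2 * (Gamma (2 * H + 1) * sin (π * H)))) := by
  have hΓ : 0 < Gamma (2 * H + 1) := Gamma_pos_of_pos (by linarith)
  have h_cos (x : ℝ) : 0 ≤ 1 - cos x := by linarith [cos_le_one x]
  suffices ENNReal.ofReal (Gamma (2 * H + 1)) *
      ∫⁻ x in Ioi (0 : ℝ), ENNReal.ofReal ((1 - cos x) * x ^ (-1 - 2 * H))
      = ENNReal.ofReal (π / (2 * sin (π * H))) by
    rw [← ENNReal.mul_right_inj (by simpa using hΓ) ENNReal.ofReal_ne_top, this,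
      ← ENNReal.ofReal_mul hΓ.le]
    congr 1
    field_simp
  calc ENNReal.ofReal (Gamma (2 * H + 1)) *
        ∫⁻ x in Ioi (0 : ℝ), ENNReal.ofReal ((1 - cos x) * x ^ (-1 - 2 * H))
      = ∫⁻ x in Ioi (0 : ℝ), ∫⁻ s in Ioi (0 : ℝ),
          ENNReal.ofReal ((1 - cos x) * (s ^ (2 * H + 1 - 1) * exp (-(x * s)))) := by
        rw [← lintegral_const_mul' _ _ ENNReal.ofReal_ne_top]
        refine setLIntegral_congr_fun measurableSet_Ioi fun x hx => ?_
        simp_rw [ENNReal.ofReal_mul (h_cos x)]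
        rw [lintegral_const_mul' _ _ ENNReal.ofReal_ne_top,
          lintegral_ofReal_rpow_mul_exp (by linarith) hx, mul_left_comm,
          ← ENNReal.ofReal_mul hΓ.le]
        ring_nf
    _ = ∫⁻ s in Ioi (0 : ℝ), ∫⁻ x in Ioi (0 : ℝ),
          ENNReal.ofReal (s ^ (2 * H) * ((1 - cos x) * exp (-(s * x)))) := by
        rw [lintegral_lintegral_swap (by fun_prop)]
        congr! 5 with s x
        rw [add_sub_cancel_right, mul_comm x s]
        ring
    _ = ∫⁻ s in Ioi (0 : ℝ), ENNReal.ofReal (s ^ (2 * H - 1) / (1 + s ^ 2)) := by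
        refine setLIntegral_congr_fun measurableSet_Ioi fun s (hs : 0 < s) => ?_
        have hpow : 0 ≤ s ^ (2 * H) := by positivity
        simp_rw [ENNReal.ofReal_mul hpow]
        rw [lintegral_const_mul' _ _ ENNReal.ofReal_ne_top,
          lintegral_ofReal_of_integral_eq (by positivity)
            (.of_forall fun x => mul_nonneg (h_cos x) (exp_pos _).le)
            (integral_one_sub_cos_mul_exp hs),
          ← ENNReal.ofReal_mul hpow, rpow_sub_one hs.ne']
        congr 1
        field_simp
    _ = ENNReal.ofReal (π / (2 * sin (π * H))) := lintegral_rpow_div_one_add_sq h0 h1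

theorem integral_one_sub_cos_mul_abs_rpow {H : ℝ} (h0 : 0 < H) (h1 : H < 1) :
    ∫ w : ℝ, (1 - cos w) * |w| ^ (-1 - 2 * H) = π / (Gamma (2 * H + 1) * sin (π * H)) := by
  have hsin := sin_pi_mul_pos h0 h1
  have h_abs := integral_comp_abs (f := fun w => (1 - cos w) * w ^ (-1 - 2 * H))
  simp only [cos_abs] at h_abs
  rw [h_abs, integral_eq_lintegral_of_nonneg_ae, lintegral_one_sub_cos_mul_rpow h0 h1,
    ENNReal.toReal_ofReal (by positivity)]
  · field_simp
  · filter_upwards [ae_restrict_mem measurableSet_Ioi] with x hx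
    exact mul_nonneg (by linarith [cos_le_one x]) (rpow_nonneg (le_of_lt hx) _)
  · exact Measurable.aestronglyMeasurable (by fun_prop)

theorem one_sub_cos_mul_mul_abs_rpow {t : ℝ} (ht : t ≠ 0) (a w : ℝ) :
    (1 - cos (t * w)) * |w| ^ a = |t| ^ (-a) * ((1 - cos (t * w)) * |t * w| ^ a) := by
  have hpow : |t| ^ (-a) * |t| ^ a = 1 := by
    rw [← rpow_add (abs_pos.2 ht), neg_add_cancel, rpow_zero]
  rw [abs_mul, mul_rpow (abs_nonneg t) (abs_nonneg w)]
  linear_combination -(1 - cos (t * w)) * |w| ^ a * hpow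

theorem integral_one_sub_cos_mul_mul_abs_rpow {H : ℝ} (h0 : 0 < H) (h1 : H < 1) (t : ℝ) :
    ∫ w : ℝ, (1 - cos (t * w)) * |w| ^ (-1 - 2 * H)
      = |t| ^ (2 * H) * (π / (Gamma (2 * H + 1) * sin (π * H))) := by
  rcases eq_or_ne t 0 with rfl | ht
  · simp [zero_rpow (by linarith : 2 * H ≠ 0)]
  simp_rw [one_sub_cos_mul_mul_abs_rpow ht]
  rw [integral_const_mul,
    Measure.integral_comp_mul_left (fun w => (1 - cos w) * |w| ^ (-1 - 2 * H)),
    integral_one_sub_cos_mul_abs_rpow h0 h1, smul_eq_mul, abs_inv, ← mul_assoc, ← rpow_neg_one,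
    ← rpow_add (abs_pos.2 ht)]
  ring_nf

end OneSubCos

section IncrementSpectrum

open Set ComplexConjugate

theorem norm_circleExp_sub_circleExp_le (x y w : ℝ) :
    ‖(Circle.exp (x * w) - Circle.exp (y * w) : ℂ)‖ ≤ 2 * (1 + |x - y|) * min 1 |w| := by
  have h_two : ‖(Circle.exp (x * w) - Circle.exp (y * w) : ℂ)‖ ≤ 2 := by
    refine (norm_sub_le _ _).trans ?_
    rw [Circle.norm_coe, Circle.norm_coe]
    norm_num
  have h_lip : ‖(Circle.exp (x * w) - Circle.exp (y * w) : ℂ)‖ ≤ |x - y| * |w| := by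
    have h_factor : (Circle.exp (x * w) - Circle.exp (y * w) : ℂ)
        = Circle.exp (y * w) * (Circle.exp ((x - y) * w) - 1) := by
      rw [mul_sub, ← Circle.coe_mul, ← Circle.exp_add]
      ring_nf
    rw [h_factor, norm_mul, Circle.norm_coe, one_mul, Circle.coe_exp, mul_comm _ Complex.I,
      ← abs_mul]
    exact Real.norm_exp_I_mul_ofReal_sub_one_le
  rcases le_total 1 |w| with h | h
  · rw [min_eq_left h]
    nlinarith [abs_nonneg (x - y)]
  · rw [min_eq_right h]
    nlinarith [abs_nonneg (x - y), abs_nonneg w]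

theorem integrable_mul_of_norm_le_mul_min {μ : Measure ℝ}
    (hμ : Integrable (fun w => min 1 |w| ^ 2) μ) {φ ψ : ℝ → ℂ} {M N : ℝ}
    (hφ : AEStronglyMeasurable φ μ) (hψ : AEStronglyMeasurable ψ μ)
    (hφM : ∀ w, ‖φ w‖ ≤ M * min 1 |w|) (hψN : ∀ w, ‖ψ w‖ ≤ N * min 1 |w|) :
    Integrable (fun w => φ w * ψ w) μ := by
  refine (hμ.const_mul (M * N)).mono' (hφ.mul hψ) (.of_forall fun w => ?_)
  calc ‖φ w * ψ w‖ = ‖φ w‖ * ‖ψ w‖ := norm_mul _ _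
    _ ≤ M * min 1 |w| * (N * min 1 |w|) :=
      mul_le_mul (hφM w) (hψN w) (norm_nonneg _) ((norm_nonneg _).trans (hφM w))
    _ = M * N * min 1 |w| ^ 2 := by ring

theorem integrable_circleExp_sub_mul_conj {μ : Measure ℝ}
    (hμ : Integrable (fun w => min 1 |w| ^ 2) μ) (x y z v : ℝ) :
    Integrable (fun w => (Circle.exp (x * w) - Circle.exp (y * w)) *
      conj (Circle.exp (z * w) - Circle.exp (v * w) : ℂ)) μ :=
  integrable_mul_of_norm_le_mul_min hμ (Continuous.aestronglyMeasurable (by fun_prop))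
    (Continuous.aestronglyMeasurable (by fun_prop)) (norm_circleExp_sub_circleExp_le x y)
    fun w => (RCLike.norm_conj _).trans_le (norm_circleExp_sub_circleExp_le z v w)

theorem re_circleExp_sub_mul_conj (x y z v w : ℝ) :
    ((Circle.exp (x * w) - Circle.exp (y * w)) *
        conj (Circle.exp (z * w) - Circle.exp (v * w) : ℂ)).re
      = (1 - Real.cos ((x - v) * w)) + (1 - Real.cos ((y - z) * w))
        - ((1 - Real.cos ((x - z) * w)) + (1 - Real.cos ((y - v) * w))) := by
  simp only [Circle.coe_exp, Complex.mul_re, Complex.sub_re, Complex.sub_im, Complex.conj_re,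
    Complex.conj_im, Complex.exp_ofReal_mul_I_re, Complex.exp_ofReal_mul_I_im, sub_mul,
    Real.cos_sub]
  ring

theorem integrable_one_sub_cos {μ : Measure ℝ} (hμ : Integrable (fun w => min 1 |w| ^ 2) μ)
    (t : ℝ) : Integrable (fun w => 1 - Real.cos (t * w)) μ := by
  refine ((integrable_circleExp_sub_mul_conj hμ t 0 t 0).re.div_const 2).congr
    (.of_forall fun w => ?_)
  change (_ : ℂ).re / 2 = 1 - Real.cos (t * w)
  rw [re_circleExp_sub_mul_conj, sub_zero, zero_sub, neg_mul, Real.cos_neg,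
    sub_self, sub_self, zero_mul, Real.cos_zero]
  ring

/-- The curve `b` in a Hilbert space has increments with spectral measure `μ`: increments have
the same inner products as the functions `w ↦ exp (i x w) - exp (i y w)` in `L²(μ)`. The measure
may be infinite near the origin. -/
structure HasIncrementSpectrum {E : Type*} [NormedAddCommGroup E] [InnerProductSpace ℝ E]
    (b : ℝ → E) (μ : Measure ℝ) : Prop where
  integrable_min_sq : Integrable (fun w => min 1 |w| ^ 2) μ
  inner_sub_sub : ∀ x y z v, ((inner ℝ (b x - b y) (b z - b v) : ℝ) : ℂ)
    = ∫ w, (Circle.exp (x * w) - Circle.exp (y * w)) *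
        conj (Circle.exp (z * w) - Circle.exp (v * w) : ℂ) ∂μ

/-- The moving average of the increments of the curve `b` with kernel `k`. -/
def incrementAverage {E : Type*} [NormedAddCommGroup E] [NormedSpace ℝ E]
    (b : ℝ → E) (k : ℝ → ℝ) (t : ℝ) : E :=
  ∫ r in Ioi (0 : ℝ), k r • (b (t - r) - b t)

/-- The transfer function of `incrementAverage`: if `b` has increments with spectral measure `μ`,
then `w ↦ exp (i t w) * incrementTransfer k w` represents `incrementAverage b k t` in `L²(μ)`. -/
def incrementTransfer (k : ℝ → ℝ) (w : ℝ) : ℂ :=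
  ∫ r in Ioi (0 : ℝ), (k r : ℂ) * (Circle.exp (-r * w) - 1)

theorem integrableOn_of_one_add_abs_mul {k : ℝ → ℝ} {s : Set ℝ}
    (hk : IntegrableOn (fun r => (1 + |r|) * k r) s) : IntegrableOn k s := by
  have hpos (r : ℝ) : 0 < 1 + |r| := by positivity
  have hcont : Continuous fun r : ℝ => (1 + |r|)⁻¹ :=
    (by fun_prop : Continuous fun r : ℝ => 1 + |r|).inv₀ fun r => (hpos r).ne'
  refine Integrable.mono (hk : Integrable _ _) ?_ (.of_forall fun r => ?_)
  · exact (hcont.aestronglyMeasurable.mul hk.aestronglyMeasurable).congr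
      (.of_forall fun r => inv_mul_cancel_left₀ (hpos r).ne' (k r))
  · rw [norm_mul, Real.norm_of_nonneg (hpos r).le]
    exact le_mul_of_one_le_left (norm_nonneg _) (by linarith [abs_nonneg r])

theorem integrableOn_smul_sub {E : Type*} [NormedAddCommGroup E] [NormedSpace ℝ E] {b : ℝ → E}
    {C : ℝ} {k : ℝ → ℝ} {s : Set ℝ} (hb : Continuous b)
    (hC : ∀ x y, ‖b x - b y‖ ≤ C * (1 + |x - y|)) (hk : IntegrableOn (fun r => (1 + |r|) * k r) s)
    (t : ℝ) : IntegrableOn (fun r => k r • (b (t - r) - b t)) s := by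
  refine (hk.norm.const_mul C).mono' ?_ (.of_forall fun r => ?_)
  · exact (integrableOn_of_one_add_abs_mul hk).aestronglyMeasurable.smul
      (by fun_prop : Continuous fun r => b (t - r) - b t).aestronglyMeasurable
  · have h_growth := hC (t - r) t
    rw [sub_sub_cancel_left, abs_neg] at h_growth
    rw [norm_smul, norm_mul, Real.norm_of_nonneg (by positivity : 0 ≤ 1 + |r|)]
    exact (mul_le_mul_of_nonneg_left h_growth (norm_nonneg _)).trans_eq (by ring)

section Transfer

variable {k : ℝ → ℝ}

theorem continuous_incrementTransfer (hk : IntegrableOn k (Ioi 0)) :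
    Continuous (incrementTransfer k) := by
  refine continuous_of_dominated (bound := fun r => |k r| * 2) (fun w => ?_)
    (fun w => .of_forall fun r => ?_) (hk.abs.mul_const 2) (.of_forall fun r => by fun_prop)
  · exact (Complex.continuous_ofReal.comp_aestronglyMeasurable hk.aestronglyMeasurable).mul
      (by fun_prop : Continuous fun r : ℝ => (Circle.exp (-r * w) - 1 : ℂ)).aestronglyMeasurable
  · rw [norm_mul, Complex.norm_real, Real.norm_eq_abs]
    gcongr
    refine (norm_sub_le _ _).trans ?_
    rw [Circle.norm_coe, norm_one]
    norm_num

theorem norm_incrementTransfer_le (hk : IntegrableOn (fun r => (1 + |r|) * k r) (Ioi 0)) (w : ℝ) :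
    ‖incrementTransfer k w‖ ≤ 2 * (∫ r in Ioi (0 : ℝ), ‖(1 + |r|) * k r‖) * min 1 |w| := by
  have h := norm_integral_le_of_norm_le (hk.norm.mul_const (2 * min 1 |w|))
    (f := fun r => (k r : ℂ) * (Circle.exp (-r * w) - 1)) (.of_forall fun r => ?_)
  · rw [integral_mul_const] at h
    exact h.trans_eq (by ring)
  · have h_exp := norm_circleExp_sub_circleExp_le (-r) 0 w
    rw [zero_mul, Circle.exp_zero, Circle.coe_one, sub_zero, abs_neg] at h_exp
    calc ‖(k r : ℂ) * (Circle.exp (-r * w) - 1)‖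
        ≤ |k r| * (2 * (1 + |r|) * min 1 |w|) := by
          rw [norm_mul, Complex.norm_real, Real.norm_eq_abs]
          gcongr
      _ = ‖(1 + |r|) * k r‖ * (2 * min 1 |w|) := by
          rw [norm_mul, Real.norm_eq_abs (k r), Real.norm_of_nonneg (by positivity)]
          ring

theorem integrable_norm_incrementTransfer_sq {μ : Measure ℝ}
    (hμ : Integrable (fun w => min 1 |w| ^ 2) μ)
    (hk : IntegrableOn (fun r => (1 + |r|) * k r) (Ioi 0)) :
    Integrable (fun w => ‖incrementTransfer k w‖ ^ 2) μ := by
  have hmeas := continuous_incrementTransfer (integrableOn_of_one_add_abs_mul hk)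
  refine (hμ.const_mul ((2 * ∫ r in Ioi 0, ‖(1 + |r|) * k r‖) ^ 2)).mono'
    (Continuous.aestronglyMeasurable (by fun_prop)) (.of_forall fun w => ?_)
  rw [norm_pow, norm_norm, ← mul_pow]
  exact pow_le_pow_left₀ (norm_nonneg _) (norm_incrementTransfer_le hk w) 2

theorem integrable_prod_mul_circleExp_sub_mul {μ : Measure ℝ} [SFinite μ]
    (hμ : Integrable (fun w => min 1 |w| ^ 2) μ)
    (hk : IntegrableOn (fun r => (1 + |r|) * k r) (Ioi 0)) {ψ : ℝ → ℂ} {N : ℝ}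
    (hψ : AEStronglyMeasurable ψ μ) (hψN : ∀ w, ‖ψ w‖ ≤ N * min 1 |w|) (t : ℝ) :
    Integrable (Function.uncurry fun r w : ℝ =>
      (k r : ℂ) * ((Circle.exp ((t - r) * w) - Circle.exp (t * w)) * ψ w))
      ((volume.restrict (Ioi 0)).prod μ) := by
  refine (hk.norm.mul_prod (hμ.const_mul (2 * N))).mono' ?_ (.of_forall fun p => ?_)
  · have h_exp : Continuous fun p : ℝ × ℝ =>
        (Circle.exp ((t - p.1) * p.2) - Circle.exp (t * p.2) : ℂ) := by fun_prop
    exact (Complex.continuous_ofReal.comp_aestronglyMeasurable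
      (integrableOn_of_one_add_abs_mul hk).aestronglyMeasurable.comp_fst).mul
        (h_exp.aestronglyMeasurable.mul hψ.comp_snd)
  · have h_exp := norm_circleExp_sub_circleExp_le (t - p.1) t p.2
    rw [sub_sub_cancel_left, abs_neg] at h_exp
    calc ‖(k p.1 : ℂ) * ((Circle.exp ((t - p.1) * p.2) - Circle.exp (t * p.2)) * ψ p.2)‖
        ≤ |k p.1| * (2 * (1 + |p.1|) * min 1 |p.2| * (N * min 1 |p.2|)) := by
          rw [norm_mul, norm_mul, Complex.norm_real, Real.norm_eq_abs]
          gcongr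
          exact hψN _
      _ = ‖(1 + |p.1|) * k p.1‖ * (2 * N * min 1 |p.2| ^ 2) := by
          rw [norm_mul, Real.norm_eq_abs (k _), Real.norm_of_nonneg (by positivity)]
          ring

theorem integral_mul_integral_circleExp_sub_mul {μ : Measure ℝ} [SFinite μ]
    (hμ : Integrable (fun w => min 1 |w| ^ 2) μ)
    (hk : IntegrableOn (fun r => (1 + |r|) * k r) (Ioi 0)) {ψ : ℝ → ℂ} {N : ℝ}
    (hψ : AEStronglyMeasurable ψ μ) (hψN : ∀ w, ‖ψ w‖ ≤ N * min 1 |w|) (t : ℝ) :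
    ∫ r in Ioi (0 : ℝ), (k r : ℂ) *
        ∫ w, (Circle.exp ((t - r) * w) - Circle.exp (t * w)) * ψ w ∂μ
      = ∫ w, Circle.exp (t * w) * incrementTransfer k w * ψ w ∂μ := by
  simp_rw [← integral_const_mul]
  rw [integral_integral_swap (integrable_prod_mul_circleExp_sub_mul hμ hk hψ hψN t)]
  congr 1 with w
  rw [incrementTransfer, ← integral_const_mul, ← integral_mul_const]
  congr 1 with r
  rw [sub_eq_add_neg t, add_mul, Circle.exp_add, Circle.coe_mul]
  ring

end Transfer

namespace HasIncrementSpectrum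

variable {E : Type*} [NormedAddCommGroup E] [InnerProductSpace ℝ E] {b : ℝ → E} {μ : Measure ℝ}
  {k : ℝ → ℝ}

theorem norm_sub_sq (hb : HasIncrementSpectrum b μ) (x y : ℝ) :
    ‖b x - b y‖ ^ 2 = ∫ w, ‖(Circle.exp (x * w) - Circle.exp (y * w) : ℂ)‖ ^ 2 ∂μ := by
  rw [← real_inner_self_eq_norm_sq, ← Complex.ofReal_inj, hb.inner_sub_sub,
    ← integral_complex_ofReal]
  simp only [Complex.mul_conj, Complex.normSq_eq_norm_sq]

theorem exists_norm_sub_le (hb : HasIncrementSpectrum b μ) :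
    ∃ C, ∀ x y, ‖b x - b y‖ ≤ C * (1 + |x - y|) := by
  set M := ∫ w, min 1 |w| ^ 2 ∂μ
  have hM : 0 ≤ M := integral_nonneg fun w => sq_nonneg _
  refine ⟨2 * √M, fun x y => le_of_sq_le_sq ?_ (by positivity)⟩
  have h_sq (w : ℝ) : ‖(Circle.exp (x * w) - Circle.exp (y * w) : ℂ)‖ ^ 2
      ≤ (2 * (1 + |x - y|)) ^ 2 * min 1 |w| ^ 2 := by
    rw [← mul_pow]
    gcongr
    exact norm_circleExp_sub_circleExp_le x y w
  calc ‖b x - b y‖ ^ 2 = ∫ w, ‖(Circle.exp (x * w) - Circle.exp (y * w) : ℂ)‖ ^ 2 ∂μ :=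
        hb.norm_sub_sq x y
    _ ≤ ∫ w, (2 * (1 + |x - y|)) ^ 2 * min 1 |w| ^ 2 ∂μ :=
        integral_mono_of_nonneg (.of_forall fun w => sq_nonneg _)
          (hb.integrable_min_sq.const_mul _) (.of_forall h_sq)
    _ = (2 * √M * (1 + |x - y|)) ^ 2 := by
        rw [integral_const_mul]
        linear_combination -(2 * (1 + |x - y|)) ^ 2 * Real.sq_sqrt hM

theorem continuous (hb : HasIncrementSpectrum b μ) : Continuous b := by
  refine continuous_iff_continuousAt.2 fun x => tendsto_iff_norm_sub_tendsto_zero.2 ?_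
  suffices Tendsto (fun y => ‖b y - b x‖ ^ 2) (𝓝 x) (𝓝 0) by
    simpa [Real.sqrt_sq] using this.sqrt
  simp_rw [hb.norm_sub_sq]
  have h_bound : ∀ᶠ y in 𝓝 x, ∀ᵐ w ∂μ,
      ‖‖(Circle.exp (y * w) - Circle.exp (x * w) : ℂ)‖ ^ 2‖ ≤ 4 ^ 2 * min 1 |w| ^ 2 := by
    filter_upwards [Metric.ball_mem_nhds x one_pos] with y hy
    refine .of_forall fun w => ?_
    rw [Real.norm_of_nonneg (sq_nonneg _), ← mul_pow]
    rw [Metric.mem_ball, Real.dist_eq] at hy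
    gcongr
    refine (norm_circleExp_sub_circleExp_le y x w).trans ?_
    gcongr
    linarith
  have h_lim := tendsto_integral_filter_of_dominated_convergence _
    (.of_forall fun y => Continuous.aestronglyMeasurable (by fun_prop)) h_bound
    (hb.integrable_min_sq.const_mul _) (.of_forall fun w => Continuous.tendsto
      (by fun_prop : Continuous fun y : ℝ =>
        ‖(Circle.exp (y * w) - Circle.exp (x * w) : ℂ)‖ ^ 2) x)
  simpa using h_lim

theorem of_norm_sub_sq [μ.IsNegInvariant] (hμ : Integrable (fun w => min 1 |w| ^ 2) μ)
    (hb : ∀ x y, ‖b x - b y‖ ^ 2 = 2 * ∫ w, (1 - Real.cos ((x - y) * w)) ∂μ) :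
    HasIncrementSpectrum b μ where
  integrable_min_sq := hμ
  inner_sub_sub x y z v := by
    have h_int := integrable_one_sub_cos hμ
    have h_polar : inner ℝ (b x - b y) (b z - b v)
        = (‖b x - b v‖ ^ 2 + ‖b y - b z‖ ^ 2 - ‖b x - b z‖ ^ 2 - ‖b y - b v‖ ^ 2) / 2 := by
      simp only [norm_sub_sq_real, inner_sub_left, inner_sub_right]
      ring
    set F : ℝ → ℂ := fun w => (Circle.exp (x * w) - Circle.exp (y * w)) *
      conj (Circle.exp (z * w) - Circle.exp (v * w) : ℂ)
    have h_real : conj (∫ w, F w ∂μ) = ∫ w, F w ∂μ := by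
      rw [← integral_conj, ← integral_neg_eq_self]
      simp only [F, map_mul, map_sub, ← Circle.coe_inv_eq_conj, ← Circle.exp_neg, mul_neg, neg_neg]
    rw [← Complex.conj_eq_iff_re.1 h_real, Complex.ofReal_inj, h_polar,
      show (∫ w, F w ∂μ).re = ∫ w, (F w).re ∂μ from
        (integral_re (integrable_circleExp_sub_mul_conj hμ x y z v)).symm]
    simp only [F, re_circleExp_sub_mul_conj]
    rw [integral_sub ((h_int _).fun_add (h_int _)) ((h_int _).fun_add (h_int _)),
      integral_add (h_int _) (h_int _), integral_add (h_int _) (h_int _), hb, hb, hb, hb]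
    ring

theorem inner_incrementAverage_of_inner_sub [CompleteSpace E] [SFinite μ]
    (hμ : Integrable (fun w => min 1 |w| ^ 2) μ)
    (hk : IntegrableOn (fun r => (1 + |r|) * k r) (Ioi 0)) {s : ℝ}
    (hs : IntegrableOn (fun r => k r • (b (s - r) - b s)) (Ioi 0)) {u : E} {ψ : ℝ → ℂ} {N : ℝ}
    (hψ : AEStronglyMeasurable ψ μ) (hψN : ∀ w, ‖ψ w‖ ≤ N * min 1 |w|)
    (hu : ∀ x y, ((inner ℝ (b x - b y) u : ℝ) : ℂ)
      = ∫ w, (Circle.exp (x * w) - Circle.exp (y * w)) * ψ w ∂μ) :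
    ((inner ℝ (incrementAverage b k s) u : ℝ) : ℂ)
      = ∫ w, Circle.exp (s * w) * incrementTransfer k w * ψ w ∂μ := by
  rw [real_inner_comm, incrementAverage, ← integral_inner hs, ← integral_complex_ofReal,
    ← integral_mul_integral_circleExp_sub_mul hμ hk hψ hψN]
  congr 1 with r
  rw [inner_smul_right, real_inner_comm, Complex.ofReal_mul, hu]

theorem inner_incrementAverage [CompleteSpace E] [SFinite μ] (hb : HasIncrementSpectrum b μ)
    (hk : IntegrableOn (fun r => (1 + |r|) * k r) (Ioi 0)) (s t : ℝ) :
    ((inner ℝ (incrementAverage b k s) (incrementAverage b k t) : ℝ) : ℂ)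
      = ∫ w, Circle.exp ((s - t) * w) * ((‖incrementTransfer k w‖ ^ 2 : ℝ) : ℂ) ∂μ := by
  obtain ⟨C, hC⟩ := hb.exists_norm_sub_le
  have h_avg := integrableOn_smul_sub hb.continuous hC hk
  have h_cross (x y : ℝ) : ((inner ℝ (b x - b y) (incrementAverage b k t) : ℝ) : ℂ)
      = ∫ w, (Circle.exp (x * w) - Circle.exp (y * w)) *
          conj (Circle.exp (t * w) * incrementTransfer k w) ∂μ := by
    rw [real_inner_comm, ← Complex.conj_ofReal, inner_incrementAverage_of_inner_sub
      hb.integrable_min_sq hk (h_avg t) (Continuous.aestronglyMeasurable (by fun_prop))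
      (fun w => (RCLike.norm_conj _).trans_le (norm_circleExp_sub_circleExp_le x y w))
      (fun z v => hb.inner_sub_sub z v x y), ← integral_conj]
    simp only [map_mul, Complex.conj_conj, mul_comm]
  have h_meas := continuous_incrementTransfer (integrableOn_of_one_add_abs_mul hk)
  have h_bound (w : ℝ) : ‖conj (Circle.exp (t * w) * incrementTransfer k w)‖
      ≤ 2 * (∫ r in Ioi (0 : ℝ), ‖(1 + |r|) * k r‖) * min 1 |w| := by
    rw [RCLike.norm_conj, norm_mul, Circle.norm_coe, one_mul]
    exact norm_incrementTransfer_le hk w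
  rw [inner_incrementAverage_of_inner_sub hb.integrable_min_sq hk (h_avg s)
    (Continuous.aestronglyMeasurable (by fun_prop)) h_bound h_cross]
  congr 1 with w
  rw [sub_mul, Circle.exp_sub, ← Complex.normSq_eq_norm_sq, Complex.normSq_eq_conj_mul_self,
    (starRingEnd ℂ).map_mul, div_eq_mul_inv, Circle.coe_mul, Circle.coe_inv_eq_conj]
  ring

end HasIncrementSpectrum

end IncrementSpectrum

section FractionalSpectrum

open Set ComplexConjugate

/-- The spectral density `Γ(2H+1) sin(πH) |w|^(-1-2H) / 2π` of the increments of fractional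
Brownian motion, normalised so that its variogram is `|t|^(2H)`. -/
def fractionalDensity (H w : ℝ) : ℝ :=
  Real.Gamma (2 * H + 1) * Real.sin (Real.pi * H) / (2 * Real.pi) * |w| ^ (-1 - 2 * H)

/-- The measure on the line with density `fractionalDensity H`. -/
def fractionalMeasure (H : ℝ) : Measure ℝ :=
  volume.withDensity fun w => ENNReal.ofReal (fractionalDensity H w)

instance (H : ℝ) : SFinite (fractionalMeasure H) := by
  unfold fractionalMeasure
  infer_instance

variable {H : ℝ}

theorem fractionalDensity_nonneg (h0 : 0 < H) (h1 : H < 1) (w : ℝ) : 0 ≤ fractionalDensity H w := by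
  have hsin := sin_pi_mul_pos h0 h1
  unfold fractionalDensity
  positivity

theorem measurable_fractionalDensity (H : ℝ) : Measurable (fractionalDensity H) := by
  unfold fractionalDensity
  fun_prop

instance (H : ℝ) : (fractionalMeasure H).IsNegInvariant := by
  refine ⟨Measure.ext fun s hs => ?_⟩
  rw [Measure.neg_apply, fractionalMeasure, withDensity_apply _ hs, withDensity_apply _ hs.neg,
    ← lintegral_indicator hs, ← lintegral_indicator hs.neg, ← lintegral_neg_eq_self]
  congr 1 with w
  by_cases hw : w ∈ s <;> simp [hw, fractionalDensity]

theorem integral_fractionalMeasure {F : Type*} [NormedAddCommGroup F] [NormedSpace ℝ F]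
    (h0 : 0 < H) (h1 : H < 1) (f : ℝ → F) :
    ∫ w, f w ∂fractionalMeasure H = ∫ w, fractionalDensity H w • f w := by
  rw [fractionalMeasure, integral_withDensity_eq_integral_toReal_smul
    (measurable_fractionalDensity H).ennreal_ofReal (by simp)]
  simp only [ENNReal.toReal_ofReal (fractionalDensity_nonneg h0 h1 _)]

theorem integrable_fractionalMeasure_iff {F : Type*} [NormedAddCommGroup F] [NormedSpace ℝ F]
    (h0 : 0 < H) (h1 : H < 1) {f : ℝ → F} :
    Integrable f (fractionalMeasure H) ↔ Integrable fun w => fractionalDensity H w • f w := by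
  rw [fractionalMeasure, integrable_withDensity_iff_integrable_smul'
    (measurable_fractionalDensity H).ennreal_ofReal (by simp)]
  simp only [ENNReal.toReal_ofReal (fractionalDensity_nonneg h0 h1 _)]

theorem integrable_abs_rpow_mul_min_sq (h0 : 0 < H) (h1 : H < 1) :
    Integrable fun w : ℝ => |w| ^ (-1 - 2 * H) * min 1 |w| ^ 2 := by
  have h_small : IntegrableOn (fun x : ℝ => x ^ (-1 - 2 * H) * min 1 x ^ 2) (Ioc 0 1) := by
    have h_pow : IntegrableOn (fun x : ℝ => x ^ (1 - 2 * H)) (Ioc 0 1) :=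
      (intervalIntegrable_iff_integrableOn_Ioc_of_le zero_le_one).1
        (intervalIntegral.intervalIntegrable_rpow' (by linarith))
    refine h_pow.congr_fun (fun x hx => ?_) measurableSet_Ioc
    simp only
    rw [min_eq_right hx.2, ← Real.rpow_natCast, ← Real.rpow_add hx.1]
    ring_nf
  have h_large : IntegrableOn (fun x : ℝ => x ^ (-1 - 2 * H) * min 1 x ^ 2) (Ioi 1) := by
    refine (integrableOn_Ioi_rpow_of_lt (by linarith : -1 - 2 * H < -1) one_pos).congr_fun
      (fun x hx => ?_) measurableSet_Ioi
    rw [min_eq_left (le_of_lt hx), one_pow, mul_one]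
  have h_half := Ioc_union_Ioi_eq_Ioi (zero_le_one' ℝ) ▸ h_small.union h_large
  simpa using (integrable_fun_norm_addHaar (E := ℝ) volume
    (f := fun x => x ^ (-1 - 2 * H) * min 1 x ^ 2)).2 (by simpa using h_half)

theorem integrable_min_sq_fractionalMeasure (h0 : 0 < H) (h1 : H < 1) :
    Integrable (fun w => min 1 |w| ^ 2) (fractionalMeasure H) := by
  rw [integrable_fractionalMeasure_iff h0 h1]
  simpa only [fractionalDensity, smul_eq_mul, mul_assoc] using
    (integrable_abs_rpow_mul_min_sq h0 h1).const_mul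
      (Real.Gamma (2 * H + 1) * Real.sin (Real.pi * H) / (2 * Real.pi))

theorem two_mul_integral_one_sub_cos_fractionalMeasure (h0 : 0 < H) (h1 : H < 1) (t : ℝ) :
    2 * ∫ w, (1 - Real.cos (t * w)) ∂fractionalMeasure H = |t| ^ (2 * H) := by
  have hΓ : Real.Gamma (2 * H + 1) ≠ 0 := (Real.Gamma_pos_of_pos (by linarith)).ne'
  have hsin : Real.sin (Real.pi * H) ≠ 0 := (sin_pi_mul_pos h0 h1).ne'
  simp only [integral_fractionalMeasure h0 h1, fractionalDensity, smul_eq_mul,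
    mul_assoc _ (|_| ^ _), mul_comm (|_| ^ _)]
  rw [integral_const_mul, integral_one_sub_cos_mul_mul_abs_rpow h0 h1]
  generalize Real.sin (Real.pi * H) = S at hsin ⊢
  field_simp

theorem hasIncrementSpectrum_fractionalMeasure {E : Type*} [NormedAddCommGroup E]
    [InnerProductSpace ℝ E] {b : ℝ → E} (h0 : 0 < H) (h1 : H < 1)
    (hb : ∀ x y, ‖b x - b y‖ ^ 2 = |x - y| ^ (2 * H)) :
    HasIncrementSpectrum b (fractionalMeasure H) :=
  .of_norm_sub_sq (integrable_min_sq_fractionalMeasure h0 h1) fun x y => by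
    rw [hb, two_mul_integral_one_sub_cos_fractionalMeasure h0 h1]

end FractionalSpectrum

section ExponentialDecay

open Set Asymptotics

variable {E : Type*} [NormedAddCommGroup E] {f g : ℝ → E}

/-- Exponential decay at `+∞`: this is what stability of a matrix `A` gives for `r ↦ exp (r A) v`,
and it makes all the moments of the impulse response finite. -/
def ExpDecay {E : Type*} [Norm E] (f : ℝ → E) : Prop :=
  ∃ c > 0, f =O[atTop] fun t => Real.exp (-c * t)

theorem expDecay_zero : ExpDecay fun _ : ℝ => (0 : E) :=
  ⟨1, one_pos, isBigO_zero _ _⟩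

theorem expDecay_exp_mul_smul {F : Type*} [NormedAddCommGroup F] [NormedSpace ℂ F] {z : ℂ}
    (hz : z.re < 0) (v : F) : ExpDecay fun t : ℝ => Complex.exp (t * z) • v := by
  refine ⟨-z.re, neg_pos.2 hz, .of_bound ‖v‖ (.of_forall fun t => ?_)⟩
  simp [norm_smul, Complex.norm_exp, mul_comm]

namespace ExpDecay

theorem add (hf : ExpDecay f) (hg : ExpDecay g) : ExpDecay fun t => f t + g t := by
  obtain ⟨c, hc, hf⟩ := hf
  obtain ⟨d, hd, hg⟩ := hg
  have weaken {a b : ℝ} (hab : a ≤ b) :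
      (fun t => Real.exp (-b * t)) =O[atTop] fun t => Real.exp (-a * t) := by
    refine .of_bound 1 ((eventually_ge_atTop 0).mono fun t ht => ?_)
    simpa using mul_le_mul_of_nonneg_right hab ht
  exact ⟨min c d, lt_min hc hd,
    (hf.trans (weaken (min_le_left c d))).add (hg.trans (weaken (min_le_right c d)))⟩

theorem sum {ι : Type*} {s : Finset ι} {f : ι → ℝ → E} (hf : ∀ i ∈ s, ExpDecay (f i)) :
    ExpDecay fun t => ∑ i ∈ s, f i t := by
  classical
  induction s using Finset.induction_on with
  | empty => simpa using expDecay_zero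
  | insert i s hi ih =>
    simp only [Finset.sum_insert hi]
    exact (hf i (Finset.mem_insert_self i s)).add
      (ih fun j hj => hf j (Finset.mem_insert_of_mem hj))

theorem tendsto (hf : ExpDecay f) : Tendsto f atTop (𝓝 0) := by
  obtain ⟨c, hc, hf⟩ := hf
  refine hf.trans_tendsto (Real.tendsto_exp_atBot.comp ?_)
  exact tendsto_id.const_mul_atTop_of_neg (neg_lt_zero.2 hc)

theorem integrableOn (hf : ExpDecay f) (hcont : Continuous f) : IntegrableOn f (Ioi 0) := by
  obtain ⟨c, hc, hf⟩ := hf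
  refine (integrable_norm_iff hcont.aestronglyMeasurable).1 ?_
  exact integrable_of_isBigO_exp_neg hc hcont.norm.continuousOn hf.norm_left

variable [NormedSpace ℝ E]

theorem clm_comp {F : Type*} [NormedAddCommGroup F] [NormedSpace ℝ F] (L : E →L[ℝ] F)
    (hf : ExpDecay f) : ExpDecay fun t => L (f t) := by
  obtain ⟨c, hc, hf⟩ := hf
  exact ⟨c, hc, (L.isBigO_comp f _).trans hf⟩

theorem pow_smul (k : ℕ) (hf : ExpDecay f) : ExpDecay fun t => t ^ k • f t := by
  obtain ⟨c, hc, hf⟩ := hf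
  refine ⟨c / 2, half_pos hc, ?_⟩
  have h := (isLittleO_pow_exp_pos_mul_atTop k (half_pos hc)).isBigO.smul hf
  refine h.congr_right fun t => ?_
  rw [smul_eq_mul, ← Real.exp_add]
  ring_nf

theorem one_add_abs_smul (hf : ExpDecay f) : ExpDecay fun t => (1 + |t|) • f t := by
  obtain ⟨c, hc, h⟩ := hf.add (hf.pow_smul 1)
  refine ⟨c, hc, h.congr' ?_ .rfl⟩
  filter_upwards [eventually_ge_atTop 0] with t ht
  rw [abs_of_nonneg ht, add_smul, one_smul, pow_one]

end ExpDecay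

end ExponentialDecay

section MatrixExponential

open scoped Matrix.Norms.Operator

variable {ι : Type*} [Fintype ι] [DecidableEq ι]

theorem exp_smul_mulVec_of_pow_mulVec_eq_zero {M : Matrix ι ι ℂ} {z : ℂ} {k : ℕ} {v : ι → ℂ}
    (hv : (M - z • 1) ^ k *ᵥ v = 0) (t : ℝ) :
    NormedSpace.exp (t • M) *ᵥ v = ∑ j ∈ Finset.range k,
      t ^ j • Complex.exp (t * z) • ((j.factorial : ℂ)⁻¹ • ((M - z • 1) ^ j *ᵥ v)) := by
  set N := M - z • 1
  have hexp : NormedSpace.exp (t • M) = Complex.exp (t * z) • NormedSpace.exp (t • N) := by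
    have hcomm : Commute ((t * z : ℂ) • (1 : Matrix ι ι ℂ)) (t • N) :=
      (Commute.one_left _).smul_left _
    have hM : t • M = (t * z : ℂ) • (1 : Matrix ι ι ℂ) + t • N := by
      simp only [N, smul_sub, ← smul_assoc, Complex.real_smul, add_sub_cancel]
    have hscalar :
        NormedSpace.exp ((t * z : ℂ) • (1 : Matrix ι ι ℂ)) = Complex.exp (t * z) • 1 := by
      rw [Complex.exp_eq_exp_ℂ, ← Algebra.algebraMap_eq_smul_one, ← Algebra.algebraMap_eq_smul_one]
      exact (NormedSpace.algebraMap_exp_comm _).symm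
    rw [hM, Matrix.exp_add_of_commute _ _ hcomm, hscalar, smul_mul_assoc, one_mul]
  have hzero (j : ℕ) (hj : j ∉ Finset.range k) : N ^ j *ᵥ v = 0 := by
    obtain ⟨i, rfl⟩ := Nat.exists_eq_add_of_le' (not_lt.1 (Finset.mem_range.not.1 hj))
    rw [pow_add, ← mulVec_mulVec, hv, mulVec_zero]
  have hsum := (NormedSpace.exp_series_hasSum_exp' (𝕂 := ℂ) (t • N)).map
    ((mulVecBilin ℂ ℂ).flip v) (LinearMap.continuous_of_finiteDimensional _)
  have hfin : HasSum (fun j => ((j.factorial : ℂ)⁻¹ • (t • N) ^ j) *ᵥ v)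
      (∑ j ∈ Finset.range k, ((j.factorial : ℂ)⁻¹ • (t • N) ^ j) *ᵥ v) :=
    hasSum_sum_of_ne_finset_zero fun j hj => by
      rw [smul_mulVec, smul_pow, smul_mulVec, hzero j hj, smul_zero, smul_zero]
  have hN : NormedSpace.exp (t • N) *ᵥ v = _ := hsum.unique hfin
  rw [hexp, smul_mulVec, hN, Finset.smul_sum]
  refine Finset.sum_congr rfl fun j _ => ?_
  rw [smul_pow, smul_mulVec, smul_mulVec, smul_comm (t ^ j), smul_comm (t ^ j)]

theorem hasEigenvalue_of_mem_maxGenEigenspace {K V : Type*} [Field K] [AddCommGroup V]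
    [Module K V] {f : Module.End K V} {z : K} {v : V}
    (hv : v ∈ f.maxGenEigenspace z) (hv0 : v ≠ 0) : f.HasEigenvalue z := by
  obtain ⟨k, hk⟩ := (Module.End.mem_maxGenEigenspace _ _ _).1 hv
  refine Module.End.hasEigenvalue_of_hasGenEigenvalue (k := k)
    (Module.End.hasGenEigenvalue_iff.2 fun hbot => hv0 ((Submodule.mem_bot K).1 (hbot ▸ ?_)))
  rwa [Module.End.mem_genEigenspace_nat, LinearMap.mem_ker]

theorem expDecay_exp_smul_mulVec {M : Matrix ι ι ℂ}
    (hM : ∀ z, Module.End.HasEigenvalue (Matrix.toLin' M) z → z.re < 0) (v : ι → ℂ) :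
    ExpDecay fun t : ℝ => NormedSpace.exp (t • M) *ᵥ v := by
  have hv : v ∈ ⨆ z, Module.End.maxGenEigenspace (Matrix.toLin' M) z := by
    rw [Module.End.iSup_maxGenEigenspace_eq_top]
    trivial
  induction hv using Submodule.iSup_induction' with
  | zero => simpa using expDecay_zero
  | add x y _ _ hx hy => simpa only [mulVec_add] using hx.add hy
  | mem z v hv =>
    rcases eq_or_ne v 0 with rfl | hv0
    · simpa using expDecay_zero
    obtain ⟨k, hk⟩ := (Module.End.mem_maxGenEigenspace _ _ _).1 hv
    have hk' : (M - z • 1) ^ k *ᵥ v = 0 := by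
      rw [← Matrix.toLin'_apply, Matrix.toLin'_pow, map_sub, map_smul, Matrix.toLin'_one]
      exact hk
    simp only [exp_smul_mulVec_of_pow_mulVec_eq_zero hk']
    exact .sum fun j _ =>
      (expDecay_exp_mul_smul (hM z (hasEigenvalue_of_mem_maxGenEigenspace hv hv0)) _).pow_smul j

end MatrixExponential

section TransferFunction

open Set

/-- The transfer function `w ↦ ∫_0^∞ e^{-irw} g(r) dr` of the causal filter with impulse
response `g`, i.e. the Laplace transform of `g` on the imaginary axis. -/
def transferFunction (g : ℝ → ℂ) (w : ℝ) : ℂ :=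
  ∫ r in Ioi (0 : ℝ), (Circle.exp (-r * w) : ℂ) * g r

theorem integrableOn_circleExp_mul {g : ℝ → ℂ} {s : Set ℝ} (hg : IntegrableOn g s) (w : ℝ) :
    IntegrableOn (fun r => (Circle.exp (-r * w) : ℂ) * g r) s :=
  hg.bdd_mul (c := 1) (by fun_prop) (.of_forall fun r => (Circle.norm_coe _).le)

theorem transferFunction_zero (g : ℝ → ℂ) : transferFunction g 0 = ∫ r in Ioi (0 : ℝ), g r := by
  simp [transferFunction]

theorem transferFunction_deriv {g g' : ℝ → ℂ} (hg : ∀ r, HasDerivAt g (g' r) r)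
    (hint : IntegrableOn g (Ioi 0)) (hint' : IntegrableOn g' (Ioi 0))
    (hlim : Tendsto g atTop (𝓝 0)) (w : ℝ) :
    transferFunction g' w = Complex.I * w * transferFunction g w - g 0 := by
  have hexp (r : ℝ) : HasDerivAt (fun r : ℝ => (Circle.exp (-r * w) : ℂ))
      ((Circle.exp (-r * w) : ℂ) * (-(w * Complex.I))) r := by
    simp only [Circle.coe_exp, Complex.ofReal_mul, Complex.ofReal_neg]
    refine HasDerivAt.cexp ?_
    simpa using (((Complex.ofRealCLM.hasDerivAt (x := r)).neg.mul_const (w : ℂ)).mul_const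
      Complex.I)
  have hder (r : ℝ) : HasDerivAt (fun r : ℝ => (Circle.exp (-r * w) : ℂ) * g r)
      ((Circle.exp (-r * w) : ℂ) * g' r - Complex.I * w * ((Circle.exp (-r * w) : ℂ) * g r)) r :=
    ((hexp r).mul (hg r)).congr_deriv (by ring)
  have hvanish : Tendsto (fun r : ℝ => (Circle.exp (-r * w) : ℂ) * g r) atTop (𝓝 0) := by
    rw [tendsto_zero_iff_norm_tendsto_zero] at hlim ⊢
    simpa only [norm_mul, Circle.norm_coe, one_mul] using hlim
  have hi := integrableOn_circleExp_mul hint w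
  have hi' := integrableOn_circleExp_mul hint' w
  have h := integral_Ioi_of_hasDerivAt_of_tendsto' (fun r _ => hder r)
    (hi'.sub (hi.const_mul (Complex.I * w))) hvanish
  rw [integral_sub hi' (hi.const_mul _), integral_const_mul, neg_zero, zero_mul, Circle.exp_zero,
    Circle.coe_one, one_mul] at h
  rw [transferFunction, transferFunction]
  linear_combination h

theorem incrementTransfer_eq_sub {k : ℝ → ℝ} (hk : IntegrableOn k (Ioi 0)) (w : ℝ) :
    incrementTransfer k w
      = transferFunction (fun r => k r) w - transferFunction (fun r => k r) 0 := by
  have hk' : IntegrableOn (fun r => (k r : ℂ)) (Ioi 0) := hk.ofReal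
  rw [transferFunction_zero, transferFunction,
    ← integral_sub (integrableOn_circleExp_mul hk' w) hk']
  refine integral_congr_ae (.of_forall fun r => ?_)
  simp only
  ring

theorem incrementTransfer_deriv {g g' : ℝ → ℝ} (hg : ∀ r, HasDerivAt g (g' r) r)
    (hint : IntegrableOn g (Ioi 0)) (hint' : IntegrableOn g' (Ioi 0))
    (hlim : Tendsto g atTop (𝓝 0)) (w : ℝ) :
    incrementTransfer g' w = Complex.I * w * transferFunction (fun r => g r) w := by
  have h := transferFunction_deriv (fun r => (hg r).ofReal_comp) hint.ofReal hint'.ofReal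
    ((Complex.continuous_ofReal.tendsto' 0 0 Complex.ofReal_zero).comp hlim)
  rw [incrementTransfer_eq_sub hint', h w, h 0]
  simp

end TransferFunction

section ImpulseResponse

open Set
open scoped Matrix.Norms.Operator

variable {ι 𝕜 : Type*} [Fintype ι] [DecidableEq ι] [RCLike 𝕜]

/-- The response `r ↦ c' exp (r A) v` of the linear system with state matrix `A`, observed
through `c`, to an impulse in the direction `v`. -/
def impulseResponse (A : Matrix ι ι 𝕜) (c v : ι → 𝕜) (r : ℝ) : 𝕜 :=
  c ⬝ᵥ (NormedSpace.exp (r • A) *ᵥ v)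

theorem impulseResponse_zero (A : Matrix ι ι 𝕜) (c v : ι → 𝕜) :
    impulseResponse A c v 0 = c ⬝ᵥ v := by
  rw [impulseResponse, zero_smul, NormedSpace.exp_zero, one_mulVec]

theorem hasDerivAt_impulseResponse (A : Matrix ι ι 𝕜) (c v : ι → 𝕜) (r : ℝ) :
    HasDerivAt (impulseResponse A c v) (impulseResponse A c (A *ᵥ v) r) r := by
  let L : Matrix ι ι 𝕜 →ₗ[ℝ] 𝕜 := dotProductBilin ℝ 𝕜 c ∘ₗ (mulVecBilin ℝ ℝ).flip v
  refine (L.toContinuousLinearMap.hasFDerivAt.comp_hasDerivAt r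
    (hasDerivAt_exp_smul_const (𝕂 := ℝ) A r)).congr_deriv ?_
  rw [impulseResponse, mulVec_mulVec]
  rfl

theorem deriv_impulseResponse (A : Matrix ι ι 𝕜) (c v : ι → 𝕜) :
    deriv (impulseResponse A c v) = impulseResponse A c (A *ᵥ v) :=
  funext fun r => (hasDerivAt_impulseResponse A c v r).deriv

theorem continuous_impulseResponse (A : Matrix ι ι 𝕜) (c v : ι → 𝕜) :
    Continuous (impulseResponse A c v) :=
  continuous_iff_continuousAt.2 fun r => (hasDerivAt_impulseResponse A c v r).continuousAt

theorem contDiff_one_impulseResponse (A : Matrix ι ι 𝕜) (c v : ι → 𝕜) :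
    ContDiff ℝ 1 (impulseResponse A c v) :=
  contDiff_one_iff_deriv.2 ⟨fun r => (hasDerivAt_impulseResponse A c v r).differentiableAt,
    deriv_impulseResponse A c v ▸ continuous_impulseResponse A c (A *ᵥ v)⟩

theorem ofReal_impulseResponse (A : Matrix ι ι ℝ) (c v : ι → ℝ) (r : ℝ) :
    ((impulseResponse A c v r : ℝ) : ℂ)
      = impulseResponse (A.map Complex.ofReal) (fun i => (c i : ℂ)) (fun i => (v i : ℂ)) r := by
  have hexp : (NormedSpace.exp (r • A)).map Complex.ofReal
      = NormedSpace.exp (r • A.map Complex.ofReal) := by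
    have h := NormedSpace.map_exp (Complex.ofRealHom.mapMatrix : Matrix ι ι ℝ →+* _)
      (continuous_id.matrix_map Complex.continuous_ofReal) (r • A)
    have hsmul : Complex.ofRealHom.mapMatrix (r • A) = r • A.map Complex.ofReal := by
      ext i j
      simp
    rwa [hsmul] at h
  simp [impulseResponse, ← hexp, dotProduct, mulVec]

theorem expDecay_impulseResponse_complex {M : Matrix ι ι ℂ}
    (hM : ∀ z, Module.End.HasEigenvalue (Matrix.toLin' M) z → z.re < 0) (c v : ι → ℂ) :
    ExpDecay (impulseResponse M c v) :=
  (expDecay_exp_smul_mulVec hM v).clm_comp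
    (LinearMap.toContinuousLinearMap (dotProductBilin ℝ ℂ c : (ι → ℂ) →ₗ[ℝ] ℂ))

theorem transferFunction_impulseResponse {M : Matrix ι ι ℂ}
    (hM : ∀ z, Module.End.HasEigenvalue (Matrix.toLin' M) z → z.re < 0) (c : ι → ℂ) {v x : ι → ℂ}
    {w : ℝ} (hx : (Complex.I * w) • x - M *ᵥ x = v) :
    transferFunction (impulseResponse M c v) w = c ⬝ᵥ x := by
  have hint (u : ι → ℂ) : IntegrableOn (impulseResponse M c u) (Ioi 0) :=
    (expDecay_impulseResponse_complex hM c u).integrableOn (continuous_impulseResponse M c u)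
  have hv (r : ℝ) : impulseResponse M c v r
      = Complex.I * w * impulseResponse M c x r - impulseResponse M c (M *ᵥ x) r := by
    simp only [impulseResponse, ← hx, mulVec_sub, mulVec_smul, dotProduct_sub, dotProduct_smul,
      smul_eq_mul]
  have hT : transferFunction (impulseResponse M c v) w
      = Complex.I * w * transferFunction (impulseResponse M c x) w
        - transferFunction (impulseResponse M c (M *ᵥ x)) w := by
    simp only [transferFunction, hv, mul_sub, mul_left_comm _ (Complex.I * w)]
    rw [integral_sub ((integrableOn_circleExp_mul (hint x) w).const_mul _)
      (integrableOn_circleExp_mul (hint _) w), integral_const_mul]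
  rw [hT, transferFunction_deriv (hasDerivAt_impulseResponse M c x) (hint x) (hint _)
    (expDecay_impulseResponse_complex hM c x).tendsto, sub_sub_cancel, impulseResponse_zero]

end ImpulseResponse

section Companion

variable {p : ℕ}

theorem IsStable.expDecay_impulseResponse {A : Matrix (Fin p) (Fin p) ℝ} (hA : IsStable A)
    (c v : Fin p → ℝ) : ExpDecay (impulseResponse A c v) := by
  have h := (expDecay_impulseResponse_complex hA (fun i => (c i : ℂ)) fun i => (v i : ℂ)).clm_comp
    Complex.reCLM
  simpa only [← ofReal_impulseResponse, Complex.reCLM_apply, Complex.ofReal_re] using h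

/-- The vector `(1, z, …, z^{p-1})`, on which the companion matrix acts as multiplication by `z`
up to a multiple of `deltaVec p`. -/
def vanderVec (p : ℕ) (z : ℂ) : Fin p → ℂ := fun i => z ^ (i : ℕ)

theorem companion_mulVec_vanderVec (α : ℕ → ℝ) (z : ℂ) :
    (companion p α).map Complex.ofReal *ᵥ vanderVec p z
      = z • vanderVec p z - alphaPoly p α z • fun i => (deltaVec p i : ℂ) := by
  ext i
  simp only [mulVec, dotProduct, Matrix.map_apply, companion, vanderVec, Pi.sub_apply,
    Pi.smul_apply, deltaVec, smul_eq_mul]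
  by_cases hi : (i : ℕ) + 1 = p
  · have hsum : ∑ j ∈ Finset.Icc 1 p, (α j : ℂ) * z ^ (j - 1)
        = ∑ j : Fin p, (α (j + 1) : ℂ) * z ^ (j : ℕ) := by
      rw [← Finset.sum_range fun j => (α (j + 1) : ℂ) * z ^ j, Finset.range_eq_Ico,
        ← Finset.Ico_succ_right_eq_Icc, Finset.sum_Ico_eq_sum_range, Nat.Ico_zero_eq_range]
      simp [add_comm]
    simp only [hi, if_true, Complex.ofReal_one, mul_one, alphaPoly, hsum, ← pow_succ']
    ring
  · have hlt : (i : ℕ) + 1 < p := lt_of_le_of_ne i.2 hi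
    simp only [hi, if_false, Complex.ofReal_zero, mul_zero, sub_zero, ← pow_succ']
    rw [Finset.sum_eq_single (⟨i + 1, hlt⟩ : Fin p)]
    · simp
    · intro j _ hj
      simp [show (j : ℕ) ≠ i + 1 from fun h => hj (Fin.ext h)]
    · simp

theorem alphaPoly_ne_zero (hp : 0 < p) {α : ℕ → ℝ} (hA : IsStable (companion p α)) {z : ℂ}
    (hz : 0 ≤ z.re) : alphaPoly p α z ≠ 0 := by
  intro h0
  have hne : vanderVec p z ≠ 0 := fun h => by
    simpa [vanderVec] using congrFun h ⟨0, hp⟩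
  refine hz.not_gt (hA z (Module.End.hasEigenvalue_of_hasEigenvector
    (Module.End.hasEigenvector_iff.2 ⟨Module.End.mem_eigenspace_iff.2 ?_, hne⟩)))
  have h := companion_mulVec_vanderVec (p := p) α z
  rwa [h0, zero_smul, sub_zero] at h

theorem betaVec_dotProduct_vanderVec {q : ℕ} (hqp : q < p) (β : ℕ → ℝ) (z : ℂ) :
    (fun i => (betaVec p q β i : ℂ)) ⬝ᵥ vanderVec p z = betaPoly q β z := by
  let f : ℕ → ℂ := fun i => ((if i = 0 then 1 else if i ≤ q then β i else 0 : ℝ) : ℂ) * z ^ i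
  change ∑ i : Fin p, f i = _
  have hvanish : ∀ i ∈ Finset.range p, i ∉ Finset.range (q + 1) → f i = 0 := fun i _ hi => by
    rw [Finset.mem_range, not_lt] at hi
    simp [f, show i ≠ 0 by omega, show ¬ i ≤ q by omega]
  rw [← Finset.sum_range f, ← Finset.sum_subset (Finset.range_mono hqp) hvanish,
    Finset.sum_range_succ', add_comm, betaPoly, ← Finset.Ico_succ_right_eq_Icc,
    Finset.sum_Ico_eq_sum_range]
  congr 1
  · simp [f]
  · refine Finset.sum_congr rfl fun i hi => ?_
    have hi' : i + 1 ≤ q := Finset.mem_range.1 hi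
    simp [f, hi', add_comm]

theorem transferFunction_impulseResponse_companion {q : ℕ} (hqp : q < p) {α : ℕ → ℝ} (β : ℕ → ℝ)
    (hA : IsStable (companion p α)) (w : ℝ) :
    transferFunction
        (fun r => ((impulseResponse (companion p α) (betaVec p q β) (deltaVec p) r : ℝ) : ℂ)) w
      = betaPoly q β (Complex.I * w) / alphaPoly p α (Complex.I * w) := by
  set z : ℂ := Complex.I * w
  have hα : alphaPoly p α z ≠ 0 := alphaPoly_ne_zero (by omega) hA (by simp [z])
  have hresolvent : z • ((alphaPoly p α z)⁻¹ • vanderVec p z)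
      - (companion p α).map Complex.ofReal *ᵥ ((alphaPoly p α z)⁻¹ • vanderVec p z)
      = fun i => (deltaVec p i : ℂ) := by
    rw [mulVec_smul, companion_mulVec_vanderVec, smul_comm z, ← smul_sub, sub_sub_cancel,
      inv_smul_smul₀ hα]
  simp only [ofReal_impulseResponse]
  rw [transferFunction_impulseResponse hA _ hresolvent, dotProduct_smul,
    betaVec_dotProduct_vanderVec hqp, smul_eq_mul, inv_mul_eq_div]

theorem integral_impulseResponse_companion {q : ℕ} (hqp : q < p) {α : ℕ → ℝ} (β : ℕ → ℝ)
    (hA : IsStable (companion p α)) :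
    ∫ r in Set.Ioi (0 : ℝ), impulseResponse (companion p α) (betaVec p q β) (deltaVec p) r
      = -(1 / α 1) := by
  have hα : alphaPoly p α 0 = -(α 1 : ℂ) := by
    rw [alphaPoly, zero_pow (by omega), Finset.sum_eq_single_of_mem 1 (by simp; omega)]
    · simp
    · intro j hj hj1
      rw [zero_pow (by simp at hj; omega), mul_zero]
  have hβ : betaPoly q β 0 = 1 := by
    rw [betaPoly, Finset.sum_eq_zero, add_zero]
    intro j hj
    rw [zero_pow (by simp at hj; omega), mul_zero]
  have h := transferFunction_impulseResponse_companion hqp β hA 0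
  rw [transferFunction_zero, Complex.ofReal_zero, mul_zero, hα, hβ, integral_complex_ofReal] at h
  exact_mod_cast h.trans (div_neg 1)

end Companion

section Stieltjes

open Set

variable {E : Type*} [NormedAddCommGroup E] [NormedSpace ℝ E]

/-- The Stieltjes integral `∫_a^t f db` of a continuously differentiable function `f` along a
continuous curve `b`, encoded by integration by parts so that `b` need not have bounded
variation. -/
def stieltjesIntegral (b : ℝ → E) (f : ℝ → ℝ) (a t : ℝ) : E :=
  f t • b t - f a • b a - ∫ u in a..t, deriv f u • b u

/-- The Riemann sum of `f` along the curve `b`, for the division points `u` and the tags `τ`. -/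
def riemannSum (b : ℝ → E) (f : ℝ → ℝ) (n : ℕ) (u τ : ℕ → ℝ) : E :=
  ∑ k ∈ Finset.range n, f (τ k) • (b (u (k + 1)) - b (u k))

/-- The points `u 0, …, u n` and the tags `τ 0, …, τ (n - 1)` form a tagged partition of `[a, t]`
of mesh at most `δ`; this is the partition occurring in `IsIntegral`. -/
def IsTaggedPartition (a t δ : ℝ) (n : ℕ) (u τ : ℕ → ℝ) : Prop :=
  u 0 = a ∧ u n = t ∧ ∀ k < n, u k ≤ τ k ∧ τ k ≤ u (k + 1) ∧ u (k + 1) - u k ≤ δ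

/-- `J` is the limit of the Riemann sums of `f` along `b` over tagged partitions of `[a, t]`, as
the mesh tends to zero. -/
def IsRiemannLimit (b : ℝ → E) (f : ℝ → ℝ) (a t : ℝ) (J : E) : Prop :=
  ∀ ε > 0, ∃ δ > 0, ∀ n u τ, IsTaggedPartition a t δ n u τ → dist (riemannSum b f n u τ) J ≤ ε

theorem IsTaggedPartition.mono {a t δ δ' : ℝ} {n : ℕ} {u τ : ℕ → ℝ}
    (h : IsTaggedPartition a t δ n u τ) (hδ : δ ≤ δ') : IsTaggedPartition a t δ' n u τ :=
  ⟨h.1, h.2.1, fun k hk => (h.2.2 k hk).imp_right (And.imp_right hδ.trans')⟩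

theorem IsTaggedPartition.mem_Icc {a t δ : ℝ} {n : ℕ} {u τ : ℕ → ℝ}
    (h : IsTaggedPartition a t δ n u τ) {k : ℕ} (hk : k ≤ n) : u k ∈ Icc a t := by
  obtain ⟨h0, hn, hstep⟩ := h
  have hmono : Monotone fun k => u (min k n) := by
    refine monotone_nat_of_le_succ fun k => ?_
    rcases lt_or_ge k n with hkn | hkn
    · rw [min_eq_left hkn.le, min_eq_left (Nat.succ_le_of_lt hkn)]
      exact (hstep k hkn).1.trans (hstep k hkn).2.1
    · rw [min_eq_right hkn, min_eq_right (by omega)]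
  have hleft := hmono (Nat.zero_le k)
  have hright := hmono hk
  simp only [Nat.zero_min, min_eq_left hk, min_self, h0, hn] at hleft hright
  exact ⟨hleft, hright⟩

theorem exists_isTaggedPartition {a t δ : ℝ} (hat : a ≤ t) (hδ : 0 < δ) :
    ∃ n u τ, IsTaggedPartition a t δ n u τ := by
  obtain ⟨n, hn⟩ := exists_nat_gt ((t - a) / δ)
  have hn0 : (0 : ℝ) < n := (div_nonneg (sub_nonneg.2 hat) hδ.le).trans_lt hn
  have hpos : 0 ≤ (t - a) / n := div_nonneg (sub_nonneg.2 hat) hn0.le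
  refine ⟨n, fun k => a + k * ((t - a) / n), fun k => a + k * ((t - a) / n), by simp, ?_,
    fun k _ => ⟨le_rfl, by push_cast; linarith, ?_⟩⟩
  · field_simp
    ring
  · rw [div_lt_iff₀ hδ] at hn
    have hwidth : (t - a) / n ≤ δ := by
      rw [div_le_iff₀ hn0]
      linarith
    push_cast
    linarith

theorem exists_seq_isTaggedPartition {a t : ℝ} (hat : a ≤ t) :
    ∃ (n : ℕ → ℕ) (u τ : ℕ → ℕ → ℝ),
      ∀ m : ℕ, IsTaggedPartition a t (1 / ((m : ℝ) + 1)) (n m) (u m) (τ m) := by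
  choose n u τ h using fun m : ℕ =>
    exists_isTaggedPartition hat (δ := 1 / ((m : ℝ) + 1)) Nat.one_div_pos_of_nat
  exact ⟨n, u, τ, h⟩

variable {b : ℝ → E} {f : ℝ → ℝ}

theorem IsRiemannLimit.tendsto {a t : ℝ} {J : E} (hJ : IsRiemannLimit b f a t J) {n : ℕ → ℕ}
    {u τ : ℕ → ℕ → ℝ}
    (hp : ∀ m : ℕ, IsTaggedPartition a t (1 / ((m : ℝ) + 1)) (n m) (u m) (τ m)) :
    Tendsto (fun m => riemannSum b f (n m) (u m) (τ m)) atTop (𝓝 J) := by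
  refine Metric.nhds_basis_closedBall.tendsto_right_iff.2 fun ε hε => ?_
  obtain ⟨δ, hδ, h⟩ := hJ ε hε
  filter_upwards [tendsto_one_div_add_atTop_nhds_zero_nat.eventually_le_const hδ] with m hm
  exact h _ _ _ ((hp m).mono hm)

theorem IsRiemannLimit.unique {a t : ℝ} (hat : a ≤ t) {J J' : E} (hJ : IsRiemannLimit b f a t J)
    (hJ' : IsRiemannLimit b f a t J') : J = J' := by
  obtain ⟨n, u, τ, hp⟩ := exists_seq_isTaggedPartition hat
  exact tendsto_nhds_unique (hJ.tendsto hp) (hJ'.tendsto hp)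

theorem stieltjesIntegral_const_smul (c : ℝ) (b : ℝ → E) (f : ℝ → ℝ) (a t : ℝ) :
    stieltjesIntegral (fun u => c • b u) f a t = c • stieltjesIntegral b f a t := by
  simp only [stieltjesIntegral, smul_comm _ c, intervalIntegral.integral_smul, smul_sub]

theorem intervalIntegrable_deriv_smul (hb : Continuous b) (hf : ContDiff ℝ 1 f) (x y : ℝ) :
    IntervalIntegrable (fun s => deriv f s • b s) volume x y :=
  ((hf.continuous_deriv le_rfl).smul hb).intervalIntegrable x y

theorem stieltjesIntegral_sub_stieltjesIntegral (hb : Continuous b) (hf : ContDiff ℝ 1 f)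
    (x y z : ℝ) :
    stieltjesIntegral b f x z - stieltjesIntegral b f y z = stieltjesIntegral b f x y := by
  simp only [stieltjesIntegral]
  rw [← intervalIntegral.integral_add_adjacent_intervals
    (intervalIntegrable_deriv_smul hb hf x y) (intervalIntegrable_deriv_smul hb hf y z)]
  abel

theorem sum_stieltjesIntegral (hb : Continuous b) (hf : ContDiff ℝ 1 f) (n : ℕ) (u : ℕ → ℝ) :
    ∑ k ∈ Finset.range n, stieltjesIntegral b f (u k) (u (k + 1))
      = stieltjesIntegral b f (u 0) (u n) := by
  simp only [stieltjesIntegral]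
  rw [Finset.sum_sub_distrib, Finset.sum_range_sub (fun k => f (u k) • b (u k)),
    intervalIntegral.sum_integral_adjacent_intervals fun k _ =>
      intervalIntegrable_deriv_smul hb hf _ _]

variable [CompleteSpace E]

theorem smul_sub_stieltjesIntegral_eq_integral (hb : Continuous b) (hf : ContDiff ℝ 1 f)
    (x y : ℝ) :
    f y • (b y - b x) - stieltjesIntegral b f x y = ∫ s in x..y, deriv f s • (b s - b x) := by
  simp only [smul_sub]
  rw [intervalIntegral.integral_sub (intervalIntegrable_deriv_smul hb hf x y)
      (intervalIntegrable_deriv_smul continuous_const hf x y),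
    intervalIntegral.integral_smul_const, intervalIntegral.integral_deriv_of_contDiffOn_uIcc
      hf.contDiffOn, stieltjesIntegral]
  module

theorem norm_smul_sub_stieltjesIntegral_le (hb : Continuous b) (hf : ContDiff ℝ 1 f)
    {u τ v M η : ℝ} (hτ : τ ∈ Icc u v) (hM : ∀ s ∈ Icc u v, |deriv f s| ≤ M)
    (hη : ∀ x ∈ Icc u v, ∀ y ∈ Icc u v, ‖b x - b y‖ ≤ η) :
    ‖f τ • (b v - b u) - stieltjesIntegral b f u v‖ ≤ M * η * (v - u) := by
  have hM0 : 0 ≤ M := (abs_nonneg _).trans (hM τ hτ)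
  have hside {x : ℝ} (hx : x ∈ Icc u v) :
      ‖f τ • (b τ - b x) - stieltjesIntegral b f x τ‖ ≤ M * η * |τ - x| := by
    rw [smul_sub_stieltjesIntegral_eq_integral hb hf]
    refine intervalIntegral.norm_integral_le_of_norm_le_const fun s hs => ?_
    have hs' : s ∈ Icc u v := uIcc_subset_Icc hx hτ (uIoc_subset_uIcc hs)
    rw [norm_smul]
    exact mul_le_mul (hM s hs') (hη s hs' x hx) (norm_nonneg _) hM0
  have hu := hside ⟨le_rfl, hτ.1.trans hτ.2⟩
  have hv := hside ⟨hτ.1.trans hτ.2, le_rfl⟩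
  rw [abs_of_nonneg (sub_nonneg.2 hτ.1)] at hu
  rw [abs_of_nonpos (sub_nonpos.2 hτ.2)] at hv
  calc ‖f τ • (b v - b u) - stieltjesIntegral b f u v‖
      = ‖(f τ • (b τ - b u) - stieltjesIntegral b f u τ)
          - (f τ • (b τ - b v) - stieltjesIntegral b f v τ)‖ := by
        rw [← stieltjesIntegral_sub_stieltjesIntegral hb hf u v τ]
        congr 1
        module
    _ ≤ M * η * (τ - u) + M * η * -(τ - v) := (norm_sub_le _ _).trans (add_le_add hu hv)
    _ = M * η * (v - u) := by ring

theorem isRiemannLimit_stieltjesIntegral (hb : Continuous b) (hf : ContDiff ℝ 1 f) {a t : ℝ}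
    (hat : a ≤ t) : IsRiemannLimit b f a t (stieltjesIntegral b f a t) := by
  intro ε hε
  obtain ⟨M, hM⟩ := isCompact_Icc.exists_bound_of_continuousOn (s := Icc a t)
    (hf.continuous_deriv le_rfl).continuousOn
  have hD : 0 < M * (t - a) + 1 := by
    have := mul_nonneg ((norm_nonneg _).trans (hM a ⟨le_rfl, hat⟩)) (sub_nonneg.2 hat)
    positivity
  obtain ⟨δ, hδ, hclose⟩ := Metric.uniformContinuousOn_iff_le.1
    (isCompact_Icc.uniformContinuousOn_of_continuous hb.continuousOn) _ (div_pos hε hD)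
  refine ⟨δ, hδ, fun n u τ h => ?_⟩
  set η := ε / (M * (t - a) + 1)
  have hterm : ∀ k ∈ Finset.range n,
      ‖f (τ k) • (b (u (k + 1)) - b (u k)) - stieltjesIntegral b f (u k) (u (k + 1))‖
        ≤ M * η * (u (k + 1) - u k) := by
    intro k hk
    have hkn := Finset.mem_range.1 hk
    obtain ⟨hl, hr, hmesh⟩ := h.2.2 k hkn
    have hsub : Icc (u k) (u (k + 1)) ⊆ Icc a t :=
      Icc_subset_Icc (h.mem_Icc hkn.le).1 (h.mem_Icc hkn).2
    refine norm_smul_sub_stieltjesIntegral_le hb hf ⟨hl, hr⟩ (fun s hs => hM s (hsub hs)) ?_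
    intro x hx y hy
    rw [← dist_eq_norm]
    exact hclose x (hsub hx) y (hsub hy) ((Real.dist_le_of_mem_Icc hx hy).trans hmesh)
  calc dist (riemannSum b f n u τ) (stieltjesIntegral b f a t)
      ≤ ∑ k ∈ Finset.range n, M * η * (u (k + 1) - u k) := by
        rw [← h.1, ← h.2.1, ← sum_stieltjesIntegral hb hf, dist_eq_norm, riemannSum,
          ← Finset.sum_sub_distrib]
        exact norm_sum_le_of_le _ hterm
    _ = M * (t - a) * η := by
        rw [← Finset.mul_sum, Finset.sum_range_sub, h.1, h.2.1]
        ring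
    _ ≤ (M * (t - a) + 1) * η := by
        have : 0 < η := div_pos hε hD
        nlinarith
    _ = ε := mul_div_cancel₀ _ hD.ne'

end Stieltjes

section MeanSquare

variable {Ω : Type*} [MeasurableSpace Ω] {P : Measure Ω} {B : ℝ → Ω → ℝ} {f : ℝ → ℝ}

/-- A square-integrable process as a curve in `L²`, the setting in which its mean-square
stochastic integrals are integrals along a curve. -/
def curveLp (P : Measure Ω) (B : ℝ → Ω → ℝ) (hB : ∀ t, MemLp (B t) 2 P) (t : ℝ) : Lp ℝ 2 P :=
  (hB t).toLp (B t)

theorem memLp_riemannSum (hB : ∀ t, MemLp (B t) 2 P) (f : ℝ → ℝ) (n : ℕ) (u τ : ℕ → ℝ) :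
    MemLp (fun ω => riemannSum (fun t => B t ω) f n u τ) 2 P :=
  memLp_finsetSum _ fun k _ => ((hB (u (k + 1))).sub (hB (u k))).const_smul (f (τ k))

theorem riemannSum_curveLp (hB : ∀ t, MemLp (B t) 2 P) (f : ℝ → ℝ) (n : ℕ) (u τ : ℕ → ℝ) :
    riemannSum (curveLp P B hB) f n u τ = (memLp_riemannSum hB f n u τ).toLp _ := by
  induction n with
  | zero => exact (MemLp.toLp_zero _).symm
  | succ n ih =>
    rw [riemannSum, Finset.sum_range_succ]
    rw [riemannSum] at ih
    rw [ih, curveLp, curveLp, ← MemLp.toLp_sub, ← MemLp.toLp_const_smul, ← MemLp.toLp_add]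
    congr 1 with ω
    simp [riemannSum, Finset.sum_range_succ]

theorem isIntegral_iff_isRiemannLimit (hB : ∀ t, MemLp (B t) 2 P) {a t : ℝ} {J : Ω → ℝ} :
    IsIntegral P B f a t J ↔
      ∃ hJ : MemLp J 2 P, IsRiemannLimit (curveLp P B hB) f a t (hJ.toLp J) := by
  rw [IsIntegral, ← exists_prop]
  refine exists_congr fun hJ => forall₂_congr fun ε hε => exists_congr fun δ => and_congr_right
    fun _ => forall₃_congr fun n u τ => ?_
  rw [IsTaggedPartition, and_imp, and_imp, riemannSum_curveLp, ← edist_le_ofReal hε.le,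
    Lp.edist_toLp_toLp]
  rfl

theorem isIntegral_iff_toLp_eq (hB : ∀ t, MemLp (B t) 2 P) (hc : Continuous (curveLp P B hB))
    (hf : ContDiff ℝ 1 f) {a t : ℝ} (hat : a ≤ t) {J : Ω → ℝ} :
    IsIntegral P B f a t J ↔
      ∃ hJ : MemLp J 2 P, hJ.toLp J = stieltjesIntegral (curveLp P B hB) f a t := by
  have hlim := isRiemannLimit_stieltjesIntegral hc hf hat
  rw [isIntegral_iff_isRiemannLimit hB]
  exact exists_congr fun hJ => ⟨fun h => h.unique hat hlim, fun h => h ▸ hlim⟩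

theorem isIntegralIic_iff_tendsto (hB : ∀ t, MemLp (B t) 2 P) (hc : Continuous (curveLp P B hB))
    (hf : ContDiff ℝ 1 f) {t : ℝ} {J : Ω → ℝ} :
    IsIntegralIic P B f t J ↔ ∃ hJ : MemLp J 2 P,
      Tendsto (fun a => stieltjesIntegral (curveLp P B hB) f a t) atBot (𝓝 (hJ.toLp J)) := by
  have hdist {K : ℝ → Ω → ℝ} (hK : ∀ a < t, IsIntegral P B f a t (K a)) (hJ : MemLp J 2 P) :
      (fun a => edist (stieltjesIntegral (curveLp P B hB) f a t) (hJ.toLp J))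
        =ᶠ[atBot] fun a => eLpNorm (fun ω => K a ω - J ω) 2 P := by
    filter_upwards [eventually_lt_atBot t] with a ha
    obtain ⟨hKa, h⟩ := (isIntegral_iff_toLp_eq hB hc hf ha.le).1 (hK a ha)
    rw [← h, Lp.edist_toLp_toLp]
    rfl
  rw [IsIntegralIic, ← exists_prop]
  refine exists_congr fun hJ => ?_
  rw [tendsto_iff_edist_tendsto_0]
  refine ⟨fun ⟨K, hK, h⟩ => h.congr' (hdist hK hJ).symm, fun h => ?_⟩
  have hK : ∀ a < t, IsIntegral P B f a t (stieltjesIntegral (curveLp P B hB) f a t : Lp ℝ 2 P) :=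
    fun a ha => (isIntegral_iff_toLp_eq hB hc hf ha.le).2 ⟨Lp.memLp _, Lp.toLp_coeFn _ _⟩
  exact ⟨_, hK, h.congr' (hdist hK hJ)⟩

theorem coeFn_stieltjesIntegral_curveLp [IsFiniteMeasure P] (hB : ∀ t, MemLp (B t) 2 P)
    (hc : Continuous (curveLp P B hB)) (hpath : ∀ᵐ ω ∂P, Continuous fun t => B t ω)
    (hf : ContDiff ℝ 1 f) {a t : ℝ} (hat : a ≤ t) :
    (stieltjesIntegral (curveLp P B hB) f a t : Lp ℝ 2 P)
      =ᵐ[P] fun ω => stieltjesIntegral (fun t => B t ω) f a t := by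
  obtain ⟨n, u, τ, hp⟩ := exists_seq_isTaggedPartition hat
  refine tendstoInMeasure_ae_unique (u := atTop)
    (tendstoInMeasure_of_tendsto_Lp ((isRiemannLimit_stieltjesIntegral hc hf hat).tendsto hp))
    (tendstoInMeasure_of_tendsto_ae (fun m => (Lp.memLp _).aestronglyMeasurable) ?_)
  filter_upwards [hpath, ae_all_iff.2 fun m => (memLp_riemannSum hB f (n m) (u m) (τ m)).coeFn_toLp]
    with ω hω hsum
  simp_rw [riemannSum_curveLp, hsum]
  exact (isRiemannLimit_stieltjesIntegral hω hf hat).tendsto hp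

end MeanSquare

section Shift

open Set

variable {E : Type*} [NormedAddCommGroup E] [NormedSpace ℝ E] [CompleteSpace E] {b : ℝ → E}
  {g : ℝ → ℝ}

theorem stieltjesIntegral_comp_const_sub (hb : Continuous b) (hg : ContDiff ℝ 1 g) (a t : ℝ) :
    stieltjesIntegral b (fun u => g (t - u)) a t
      = (∫ r in 0..t - a, deriv g r • (b (t - r) - b t)) - g (t - a) • (b a - b t) := by
  have hsymm : stieltjesIntegral b (fun u => g (t - u)) t a
      = -stieltjesIntegral b (fun u => g (t - u)) a t := by
    rw [stieltjesIntegral, stieltjesIntegral, intervalIntegral.integral_symm]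
    abel
  have hshift := intervalIntegral.integral_comp_sub_left (a := t) (b := a)
    (fun r => deriv g r • (b (t - r) - b t)) t
  have h := smul_sub_stieltjesIntegral_eq_integral hb (hg.comp (contDiff_const.sub contDiff_id)) t a
    (f := fun u => g (t - u))
  simp only [sub_sub_cancel, sub_self] at hshift
  simp only [deriv_comp_const_sub, neg_smul, intervalIntegral.integral_neg, hshift, hsymm] at h
  rw [intervalIntegral.integral_symm, ← eq_sub_iff_add_eq'.2 (by simpa using h)]

theorem tendsto_const_sub_atBot_atTop (t : ℝ) : Tendsto (fun a => t - a) atBot atTop := by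
  simpa only [sub_eq_add_neg] using tendsto_atTop_add_const_left _ t tendsto_neg_atBot_atTop

theorem tendsto_stieltjesIntegral_incrementAverage (hb : Continuous b) {C : ℝ}
    (hC : ∀ x y, ‖b x - b y‖ ≤ C * (1 + |x - y|)) (hg : ContDiff ℝ 1 g)
    (hg' : IntegrableOn (fun r => (1 + |r|) * deriv g r) (Ioi 0))
    (hlim : Tendsto (fun r => (1 + |r|) * g r) atTop (𝓝 0)) (t : ℝ) :
    Tendsto (fun a => stieltjesIntegral b (fun u => g (t - u)) a t) atBot
      (𝓝 (incrementAverage b (deriv g) t)) := by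
  have hta := tendsto_const_sub_atBot_atTop t
  simp_rw [stieltjesIntegral_comp_const_sub hb hg]
  have hboundary : Tendsto (fun a => g (t - a) • (b a - b t)) atBot (𝓝 0) := by
    have hnorm := (hlim.comp hta).norm.const_mul C
    rw [norm_zero, mul_zero] at hnorm
    refine squeeze_zero_norm (fun a => ?_) hnorm
    calc ‖g (t - a) • (b a - b t)‖ ≤ ‖g (t - a)‖ * (C * (1 + |t - a|)) := by
          rw [norm_smul, abs_sub_comm]
          gcongr
          exact hC a t
      _ = C * ‖((fun r => (1 + |r|) * g r) ∘ (t - ·)) a‖ := by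
          rw [Function.comp_apply, norm_mul,
            Real.norm_of_nonneg (by positivity : 0 ≤ 1 + |t - a|)]
          ring
  simpa only [sub_zero, incrementAverage] using
    (intervalIntegral_tendsto_integral_Ioi 0 (integrableOn_smul_sub hb hC hg' t) hta).sub hboundary

end Shift

section SecondOrder

open Set

variable {Ω : Type*} [MeasurableSpace Ω] {P : Measure Ω} {B : ℝ → Ω → ℝ}

theorem norm_curveLp_sub_sq (hB : ∀ t, MemLp (B t) 2 P) (s t : ℝ) :
    ‖curveLp P B hB s - curveLp P B hB t‖ ^ 2 = ∫ ω, (B s ω - B t ω) ^ 2 ∂P := by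
  rw [curveLp, curveLp, ← MemLp.toLp_sub, ← real_inner_self_eq_norm_sq, L2.inner_def]
  refine integral_congr_ae ?_
  filter_upwards [((hB s).sub (hB t)).coeFn_toLp] with ω h
  simp [h, sq]

theorem integral_incrementAverage_curveLp [IsFiniteMeasure P] (hB : ∀ t, MemLp (B t) 2 P)
    (hmean : ∀ s t, ∫ ω, B s ω ∂P = ∫ ω, B t ω ∂P) {k : ℝ → ℝ} {t : ℝ}
    (hint : IntegrableOn (fun r => k r • (curveLp P B hB (t - r) - curveLp P B hB t)) (Ioi 0)) :
    ∫ ω, (incrementAverage (curveLp P B hB) k t : Lp ℝ 2 P) ω ∂P = 0 := by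
  set e : Lp ℝ 2 P := indicatorConstLp 2 MeasurableSet.univ (measure_ne_top P _) 1
  have he (Z : Lp ℝ 2 P) : inner ℝ e Z = ∫ ω, Z ω ∂P := by
    rw [L2.inner_indicatorConstLp_one, setIntegral_univ]
  have heB (s : ℝ) : inner ℝ e (curveLp P B hB s) = ∫ ω, B s ω ∂P := by
    rw [he]
    exact integral_congr_ae (hB s).coeFn_toLp
  rw [← he, incrementAverage, ← integral_inner hint]
  simp only [inner_smul_right, inner_sub_right, heB, hmean _ t, sub_self, mul_zero, integral_zero]

theorem covariance_const_add_mul_coeFn [IsProbabilityMeasure P] {Y₁ Y₂ : Ω → ℝ} {Z₁ Z₂ : Lp ℝ 2 P}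
    {m σ : ℝ} (h₁ : Y₁ =ᵐ[P] fun ω => m + σ * Z₁ ω) (h₂ : Y₂ =ᵐ[P] fun ω => m + σ * Z₂ ω)
    (hZ₁ : ∫ ω, Z₁ ω ∂P = 0) : cov[Y₁, Y₂; P] = σ ^ 2 * inner ℝ Z₁ Z₂ := by
  have hZ (Z : Lp ℝ 2 P) : Integrable Z P := (Lp.memLp Z).integrable one_le_two
  calc cov[Y₁, Y₂; P] = cov[fun ω => m + σ * Z₁ ω, fun ω => m + σ * Z₂ ω; P] := by
        rw [covariance, covariance, integral_congr_ae h₁, integral_congr_ae h₂]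
        refine integral_congr_ae ?_
        filter_upwards [h₁, h₂] with ω hω₁ hω₂
        rw [hω₁, hω₂]
    _ = σ * (σ * cov[Z₁, Z₂; P]) := by
        rw [covariance_const_add_left ((hZ Z₁).const_mul σ),
          covariance_const_add_right ((hZ Z₂).const_mul σ), covariance_const_mul_left,
          covariance_const_mul_right]
    _ = σ ^ 2 * inner ℝ Z₁ Z₂ := by
        rw [covariance_eq_sub (Lp.memLp Z₁) (Lp.memLp Z₂), hZ₁, L2.inner_def]
        simp only [Pi.mul_apply, RCLike.inner_apply', conj_trivial, zero_mul, sub_zero]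
        ring

end SecondOrder

section FractionalIncrements

open Set

variable {Ω : Type*} [MeasurableSpace Ω] {P : Measure Ω} {B : ℝ → Ω → ℝ} {H : ℝ}

/-- `B` is a square-integrable process whose increments are centred with the variogram
`E(B_s - B_t)² = |s - t|^(2H)` of fractional Brownian motion: the hypothesis of the
second-order theory below. -/
structure HasFractionalIncrements (P : Measure Ω) (H : ℝ) (B : ℝ → Ω → ℝ) : Prop where
  memLp : ∀ t, MemLp (B t) 2 P
  mean_eq : ∀ s t, ∫ ω, B s ω ∂P = ∫ ω, B t ω ∂P
  variogram : ∀ s t, ∫ ω, (B s ω - B t ω) ^ 2 ∂P = |s - t| ^ (2 * H)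

theorem IsFBM.hasFractionalIncrements (h0 : 0 < H) (hB : IsFBM P H B) :
    HasFractionalIncrements P H B where
  memLp t := (hB.gaussian.hasGaussianLaw_eval t).memLp_two
  mean_eq s t := by rw [hB.mean, hB.mean]
  variogram s t := by
    have hmem t := (hB.gaussian.hasGaussianLaw_eval t).memLp_two
    have hint s t : Integrable (fun ω => B t ω * B s ω) P := (hmem t).integrable_mul (hmem s)
    calc ∫ ω, (B s ω - B t ω) ^ 2 ∂P
        = ∫ ω, (B s ω * B s ω + B t ω * B t ω - 2 * (B s ω * B t ω)) ∂P := by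
          congr 1 with ω
          ring
      _ = |s - t| ^ (2 * H) := by
          rw [integral_sub ((hint s s).fun_add (hint t t)) ((hint t s).const_mul 2),
            integral_add (hint s s) (hint t t), integral_const_mul, hB.kernel, hB.kernel,
            hB.kernel, sub_self, sub_self, abs_zero, Real.zero_rpow (by positivity)]
          ring

namespace HasFractionalIncrements

theorem hasIncrementSpectrum (h0 : 0 < H) (h1 : H < 1) (hB : HasFractionalIncrements P H B) :
    HasIncrementSpectrum (curveLp P B hB.memLp) (fractionalMeasure H) :=
  hasIncrementSpectrum_fractionalMeasure h0 h1 fun x y => by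
    rw [norm_curveLp_sub_sq, hB.variogram]

theorem isIntegralIic_iff (h0 : 0 < H) (h1 : H < 1) (hB : HasFractionalIncrements P H B)
    {g : ℝ → ℝ} (hg : ContDiff ℝ 1 g)
    (hg' : IntegrableOn (fun r => (1 + |r|) * deriv g r) (Ioi 0))
    (hlim : Tendsto (fun r => (1 + |r|) * g r) atTop (𝓝 0)) (t : ℝ) {J : Ω → ℝ} :
    IsIntegralIic P B (fun u => g (t - u)) t J
      ↔ J =ᵐ[P] (incrementAverage (curveLp P B hB.memLp) (deriv g) t : Lp ℝ 2 P) := by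
  have hspec := hB.hasIncrementSpectrum h0 h1
  obtain ⟨C, hC⟩ := hspec.exists_norm_sub_le
  have hgt : ContDiff ℝ 1 fun u => g (t - u) := hg.comp (contDiff_const.sub contDiff_id)
  have htend := tendsto_stieltjesIntegral_incrementAverage hspec.continuous hC hg hg' hlim t
  rw [isIntegralIic_iff_tendsto hB.memLp hspec.continuous hgt]
  refine ⟨fun ⟨hJ, h⟩ => hJ.coeFn_toLp.symm.trans ?_, fun h => ?_⟩
  · rw [tendsto_nhds_unique h htend]
  · have hJ : MemLp J 2 P := (memLp_congr_ae h).2 (Lp.memLp _)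
    exact ⟨hJ, by rwa [(hJ.toLp_eq_toLp_iff (Lp.memLp _)).2 h, Lp.toLp_coeFn]⟩

theorem hasSpectralDensity [IsProbabilityMeasure P] (h0 : 0 < H) (h1 : H < 1)
    (hB : HasFractionalIncrements P H B) {k : ℝ → ℝ}
    (hk : IntegrableOn (fun r => (1 + |r|) * k r) (Ioi 0)) {Y : ℝ → Ω → ℝ} {m σ : ℝ}
    (hY : ∀ t, Y t =ᵐ[P] fun ω =>
      m + σ * (incrementAverage (curveLp P B hB.memLp) k t : Lp ℝ 2 P) ω) {f : ℝ → ℝ}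
    (hf0 : ∀ w, 0 ≤ f w)
    (hf : ∀ᵐ w, f w = σ ^ 2 * (fractionalDensity H w * ‖incrementTransfer k w‖ ^ 2)) :
    HasSpectralDensity P Y f := by
  have hspec := hB.hasIncrementSpectrum h0 h1
  obtain ⟨C, hC⟩ := hspec.exists_norm_sub_le
  have hmeanZ (t : ℝ) := integral_incrementAverage_curveLp hB.memLp hB.mean_eq
    (integrableOn_smul_sub hspec.continuous hC hk t)
  have hmean (t : ℝ) : ∫ ω, Y t ω ∂P = m := by
    rw [integral_congr_ae (hY t), integral_add (integrable_const m)
      (((Lp.memLp _).integrable one_le_two).const_mul σ), integral_const_mul, hmeanZ]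
    simp
  refine ⟨fun t => (memLp_congr_ae (hY t)).2 ((memLp_const m).add ((Lp.memLp _).const_mul σ)),
    fun s t => by rw [hmean, hmean], hf0, ?_, fun t h => ?_⟩
  · rw [integrable_congr hf]
    exact ((integrable_fractionalMeasure_iff h0 h1).1
      (integrable_norm_incrementTransfer_sq hspec.integrable_min_sq hk)).const_mul (σ ^ 2)
  · rw [covariance_const_add_mul_coeFn (hY _) (hY t) (hmeanZ _), Complex.ofReal_mul,
      hspec.inner_incrementAverage hk, add_sub_cancel_left, integral_fractionalMeasure h0 h1,
      ← integral_const_mul]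
    refine integral_congr_ae ?_
    filter_upwards [hf] with w hw
    rw [hw, Circle.coe_exp, Complex.real_smul]
    push_cast
    ring_nf

end HasFractionalIncrements

end FractionalIncrements

section StateEquation

open scoped Matrix.Norms.Operator

variable {ι : Type*} [Fintype ι]

/-- The continuous path `x` solves `dx_t = (A x_t + a) dt + d dc_t` on the whole line, as an
integral equation driven by the scalar path `c`. -/
structure IsPathSolution (A : Matrix ι ι ℝ) (a d : ι → ℝ) (c : ℝ → ℝ) (x : ℝ → ι → ℝ) :
    Prop where
  continuous : Continuous x
  sub_eq : ∀ s t, s ≤ t → x t - x s = (∫ u in s..t, (A *ᵥ x u + a)) + (c t - c s) • d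

namespace IsPathSolution

variable {A : Matrix ι ι ℝ} {a d : ι → ℝ} {c : ℝ → ℝ} {x : ℝ → ι → ℝ}

theorem hasDerivAt_sub_smul (h : IsPathSolution A a d c x) (t : ℝ) :
    HasDerivAt (fun u => x u - c u • d) (A *ᵥ x t + a) t := by
  have hcont : Continuous fun u => A *ᵥ x u + a := by
    have := h.continuous
    fun_prop
  have hprim (u : ℝ) : x u - c u • d = x 0 - c 0 • d + ∫ s in (0 : ℝ)..u, (A *ᵥ x s + a) := by
    rcases le_total 0 u with hu | hu
    · rw [eq_sub_of_add_eq (h.sub_eq 0 u hu).symm]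
      module
    · rw [intervalIntegral.integral_symm, eq_sub_of_add_eq (h.sub_eq u 0 hu).symm]
      module
  rw [funext hprim]
  exact (intervalIntegral.integral_hasDerivAt_right (hcont.intervalIntegrable 0 t)
    (hcont.stronglyMeasurableAtFilter _ _) hcont.continuousAt).const_add _

theorem continuous_of_ne_zero (h : IsPathSolution A a d c x) (hd : d ≠ 0) : Continuous c := by
  obtain ⟨i, hi⟩ := Function.ne_iff.1 hd
  have hsmooth : Continuous fun u => x u - c u • d :=
    continuous_iff_continuousAt.2 fun t => (h.hasDerivAt_sub_smul t).continuousAt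
  have hc : c = fun t => (x t - (x t - c t • d)) i / d i := by
    ext t
    rw [sub_sub_cancel, Pi.smul_apply, smul_eq_mul, mul_div_cancel_right₀ _ hi]
  rw [hc]
  exact ((continuous_apply i).comp (h.continuous.sub hsmooth)).div_const _

end IsPathSolution

variable [DecidableEq ι]

theorem continuous_impulseResponse_right (A : Matrix ι ι ℝ) (b : ι → ℝ) (r : ℝ) :
    Continuous fun v => impulseResponse A b v r := by
  unfold impulseResponse
  fun_prop

theorem hasDerivAt_impulseResponse_const_sub (A : Matrix ι ι ℝ) (b : ι → ℝ) {y : ℝ → ι → ℝ}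
    {y' : ι → ℝ} {u : ℝ} (hy : HasDerivAt y y' u) (t : ℝ) :
    HasDerivAt (fun u => impulseResponse A b (y u) (t - u))
      (impulseResponse A b (y' - A *ᵥ y u) (t - u)) u := by
  let L : Matrix ι ι ℝ →ₗ[ℝ] (ι → ℝ) →ₗ[ℝ] ℝ := (mulVecBilin ℝ ℝ).compr₂ (dotProductBilin ℝ ℝ b)
  have hexp := (hasDerivAt_exp_smul_const (𝕂 := ℝ) A (t - u)).comp_const_sub t u
  refine ((L.toContinuousBilinearMap.hasFDerivAt.comp_hasDerivAt u hexp).clm_apply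
    hy).congr_deriv ?_
  change b ⬝ᵥ (-(_ * A) *ᵥ y u) + b ⬝ᵥ (_ *ᵥ y') = b ⬝ᵥ (_ *ᵥ (y' - A *ᵥ y u))
  rw [neg_mulVec, ← mulVec_mulVec, mulVec_sub, ← dotProduct_add, neg_add_eq_sub]
  rfl

theorem IsPathSolution.dotProduct_eq {A : Matrix ι ι ℝ} {a d : ι → ℝ} {c : ℝ → ℝ}
    {x : ℝ → ι → ℝ} (h : IsPathSolution A a d c x) (hc : Continuous c) (b : ι → ℝ) (s t : ℝ) :
    b ⬝ᵥ x t = impulseResponse A b (x s) (t - s) + (∫ r in 0..t - s, impulseResponse A b a r)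
      + stieltjesIntegral c (fun u => impulseResponse A b d (t - u)) s t := by
  have hresp (v : ι → ℝ) : Continuous fun u => impulseResponse A b v (t - u) :=
    (continuous_impulseResponse A b v).comp (by fun_prop)
  have hderiv (u : ℝ) : HasDerivAt (fun u => impulseResponse A b (x u - c u • d) (t - u))
      (impulseResponse A b (A *ᵥ d) (t - u) * c u + impulseResponse A b a (t - u)) u := by
    refine (hasDerivAt_impulseResponse_const_sub A b (h.hasDerivAt_sub_smul u) t).congr_deriv ?_
    simp only [impulseResponse, mulVec_sub, mulVec_add, mulVec_smul, dotProduct_sub,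
      dotProduct_add, dotProduct_smul, smul_eq_mul]
    ring
  have hint_noise : IntervalIntegrable (fun u => impulseResponse A b (A *ᵥ d) (t - u) * c u)
      volume s t := ((hresp (A *ᵥ d)).mul hc).intervalIntegrable s t
  have hint_drift : IntervalIntegrable (fun u => impulseResponse A b a (t - u)) volume s t :=
    (hresp a).intervalIntegrable s t
  have hftc := intervalIntegral.integral_eq_sub_of_hasDerivAt (fun u _ => hderiv u)
    (hint_noise.add hint_drift)
  have hlin (v : ι → ℝ) (e r : ℝ) : impulseResponse A b (v - e • d) r
      = impulseResponse A b v r - e * impulseResponse A b d r := by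
    simp only [impulseResponse, mulVec_sub, mulVec_smul, dotProduct_sub, dotProduct_smul,
      smul_eq_mul]
  rw [intervalIntegral.integral_add hint_noise hint_drift, hlin, hlin, sub_self,
    impulseResponse_zero A b (x t), intervalIntegral.integral_comp_sub_left, sub_self] at hftc
  simp only [stieltjesIntegral, deriv_comp_const_sub, deriv_impulseResponse, smul_eq_mul, neg_mul,
    intervalIntegral.integral_neg, sub_self]
  linarith

end StateEquation

section Stationary

open Set

variable {Ω : Type*} [MeasurableSpace Ω] {P : Measure Ω}

namespace IsStrictlyStationary

variable {E : Type*} [MeasurableSpace E] {X : ℝ → Ω → E}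

theorem identDistrib (hX : IsStrictlyStationary P X) (s : ℝ) : IdentDistrib (X s) (X 0) P P := by
  have h := (hX {0} s).comp (measurable_pi_apply (⟨0, by simp⟩ : ({0} : Finset ℝ)))
  simpa [Function.comp_def] using h

theorem tendstoInMeasure [IsFiniteMeasure P] (hX : IsStrictlyStationary P X) {F : ℕ → E → ℝ}
    (hF : ∀ n, Measurable (F n)) (hlim : ∀ v, Tendsto (fun n => F n v) atTop (𝓝 0))
    (s : ℕ → ℝ) : TendstoInMeasure P (fun n ω => F n (X (s n) ω)) atTop 0 := by
  have h0 : TendstoInMeasure P (fun n ω => F n (X 0 ω)) atTop 0 :=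
    tendstoInMeasure_of_tendsto_ae (fun n => ((hF n).comp_aemeasurable
      (hX.identDistrib 0).aemeasurable_snd).aestronglyMeasurable) (.of_forall fun ω => hlim (X 0 ω))
  intro ε hε
  refine (h0 ε hε).congr fun n => ?_
  have hset : MeasurableSet {y : ℝ | ε ≤ edist y 0} :=
    measurableSet_le measurable_const (measurable_id.edist measurable_const)
  exact (((hX.identDistrib (s n)).comp (hF n)).measure_mem_eq hset).symm

end IsStrictlyStationary

variable {p : ℕ} {A : Matrix (Fin p) (Fin p) ℝ}

namespace IsStable

theorem integrableOn_deriv_impulseResponse (hA : IsStable A) (b v : Fin p → ℝ) :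
    IntegrableOn (fun r => (1 + |r|) * deriv (impulseResponse A b v) r) (Ioi 0) := by
  have hcont := continuous_impulseResponse A b (A *ᵥ v)
  rw [deriv_impulseResponse]
  exact (hA.expDecay_impulseResponse b (A *ᵥ v)).one_add_abs_smul.integrableOn (by fun_prop)

theorem tendsto_one_add_abs_mul_impulseResponse (hA : IsStable A) (b v : Fin p → ℝ) :
    Tendsto (fun r => (1 + |r|) * impulseResponse A b v r) atTop (𝓝 0) :=
  (hA.expDecay_impulseResponse b v).one_add_abs_smul.tendsto

end IsStable

namespace HasFractionalIncrements

variable [IsProbabilityMeasure P] {B : ℝ → Ω → ℝ} {H σ : ℝ} {a d : Fin p → ℝ}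
  {X : ℝ → Ω → Fin p → ℝ}

theorem dotProduct_ae_eq (h0 : 0 < H) (h1 : H < 1) (hB : HasFractionalIncrements P H B)
    (hσ : σ ≠ 0) (hd : d ≠ 0)
    (hX : ∀ᵐ ω ∂P, IsPathSolution A a d (fun t => σ * B t ω) fun t => X t ω) (b : Fin p → ℝ)
    {s t : ℝ} (hst : s ≤ t) :
    ∀ᵐ ω ∂P, b ⬝ᵥ X t ω = impulseResponse A b (X s ω) (t - s)
      + (∫ r in 0..t - s, impulseResponse A b a r)
      + σ * (stieltjesIntegral (curveLp P B hB.memLp) (fun u => impulseResponse A b d (t - u))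
          s t : Lp ℝ 2 P) ω := by
  have hpath : ∀ᵐ ω ∂P, Continuous fun t => B t ω := hX.mono fun ω hω => by
    simpa [inv_mul_cancel_left₀ hσ] using (hω.continuous_of_ne_zero hd).const_mul σ⁻¹
  have hf : ContDiff ℝ 1 fun u => impulseResponse A b d (t - u) :=
    (contDiff_one_impulseResponse A b d).comp (contDiff_const.sub contDiff_id)
  filter_upwards [hX, coeFn_stieltjesIntegral_curveLp hB.memLp
    (hB.hasIncrementSpectrum h0 h1).continuous hpath hf hst] with ω hω hstieltjes
  rw [hstieltjes, hω.dotProduct_eq (hω.continuous_of_ne_zero hd) b s t]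
  exact congrArg _ (stieltjesIntegral_const_smul σ _ _ _ _)

theorem dotProduct_ae_eq_incrementAverage (h0 : 0 < H) (h1 : H < 1)
    (hB : HasFractionalIncrements P H B) (hA : IsStable A) (hσ : σ ≠ 0) (hd : d ≠ 0)
    (hX : ∀ᵐ ω ∂P, IsPathSolution A a d (fun t => σ * B t ω) fun t => X t ω)
    (hs : IsStrictlyStationary P X) (b : Fin p → ℝ) (t : ℝ) :
    (fun ω => b ⬝ᵥ X t ω) =ᵐ[P] fun ω => (∫ r in Ioi 0, impulseResponse A b a r)
      + σ * (incrementAverage (curveLp P B hB.memLp) (deriv (impulseResponse A b d)) t :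
          Lp ℝ 2 P) ω := by
  have hspec := hB.hasIncrementSpectrum h0 h1
  obtain ⟨C, hC⟩ := hspec.exists_norm_sub_le
  have htail : Tendsto (fun n : ℕ => t - n) atTop atBot := by
    simpa only [sub_eq_add_neg, Function.comp_def] using tendsto_atBot_add_const_left _ t
      (tendsto_neg_atTop_atBot.comp tendsto_natCast_atTop_atTop)
  have hnoise := (tendsto_stieltjesIntegral_incrementAverage hspec.continuous hC
    (contDiff_one_impulseResponse A b d) (hA.integrableOn_deriv_impulseResponse b d)
    (hA.tendsto_one_add_abs_mul_impulseResponse b d) t).comp htail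
  have hdrift := intervalIntegral_tendsto_integral_Ioi 0
    ((hA.expDecay_impulseResponse b a).integrableOn (continuous_impulseResponse A b a))
    tendsto_natCast_atTop_atTop
  have hstart := hs.tendstoInMeasure (F := fun n v => impulseResponse A b v n)
    (fun n => (continuous_impulseResponse_right A b n).measurable)
    (fun v => (hA.expDecay_impulseResponse b v).tendsto.comp tendsto_natCast_atTop_atTop)
    (fun n => t - n)
  obtain ⟨ns, hns, hstart'⟩ := hstart.exists_seq_tendsto_ae
  obtain ⟨ms, hms, hnoise'⟩ := (tendstoInMeasure_of_tendsto_Lp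
    (hnoise.comp hns.tendsto_atTop)).exists_seq_tendsto_ae
  filter_upwards [hstart', hnoise', ae_all_iff.2 fun n : ℕ =>
    hB.dotProduct_ae_eq h0 h1 hσ hd hX b (sub_le_self t n.cast_nonneg)] with ω hωs hωn hω
  have hlim := ((hωs.comp hms.tendsto_atTop).add
    ((hdrift.comp hns.tendsto_atTop).comp hms.tendsto_atTop)).add (hωn.const_mul σ)
  rw [Pi.zero_apply, zero_add] at hlim
  refine tendsto_nhds_unique (tendsto_const_nhds.congr fun n => ?_) hlim
  simpa only [Function.comp_apply, sub_sub_cancel] using hω (ns (ms n))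

end HasFractionalIncrements

end Stationary

section CarfimaProcess

variable {Ω : Type*} [MeasurableSpace Ω] {P : Measure Ω} {B : ℝ → Ω → ℝ} {H σ : ℝ} {p q : ℕ}
  {α β : ℕ → ℝ}

/-- The moving-average kernel `r ↦ β' exp(rA) δ_p` of the CARFIMA process. -/
def carfimaKernel (p q : ℕ) (α β : ℕ → ℝ) : ℝ → ℝ :=
  impulseResponse (companion p α) (betaVec p q β) (deltaVec p)

theorem incrementTransfer_deriv_carfimaKernel (hqp : q < p) (hA : IsStable (companion p α))
    (w : ℝ) :
    incrementTransfer (deriv (carfimaKernel p q α β)) w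
      = Complex.I * w * (betaPoly q β (Complex.I * w) / alphaPoly p α (Complex.I * w)) := by
  have hdecay (v : Fin p → ℝ) := hA.expDecay_impulseResponse (betaVec p q β) v
  rw [carfimaKernel, deriv_impulseResponse, incrementTransfer_deriv
    (hasDerivAt_impulseResponse _ _ _) ((hdecay _).integrableOn (continuous_impulseResponse _ _ _))
    ((hdecay _).integrableOn (continuous_impulseResponse _ _ _)) (hdecay _).tendsto,
    transferFunction_impulseResponse_companion hqp β hA]

theorem carfimaDensity_nonneg (h0 : 0 < H) (h1 : H < 1) (w : ℝ) :
    0 ≤ carfimaDensity p q α β H σ w := by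
  have hsin := sin_pi_mul_pos h0 h1
  unfold carfimaDensity
  positivity

theorem carfimaDensity_eq_of_ne_zero (hqp : q < p) (hA : IsStable (companion p α)) {w : ℝ}
    (hw : w ≠ 0) :
    carfimaDensity p q α β H σ w = σ ^ 2 * (fractionalDensity H w
      * ‖incrementTransfer (deriv (carfimaKernel p q α β)) w‖ ^ 2) := by
  have hpow : |w| ^ (1 - 2 * H) = |w| ^ 2 * |w| ^ (-1 - 2 * H) := by
    rw [← Real.rpow_two, ← Real.rpow_add (abs_pos.2 hw)]
    ring_nf
  rw [incrementTransfer_deriv_carfimaKernel hqp hA, norm_mul, norm_mul, norm_div, Complex.norm_I,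
    Complex.norm_real, Real.norm_eq_abs, carfimaDensity, fractionalDensity, hpow]
  ring

namespace HasFractionalIncrements

theorem isMovingAverage_iff (h0 : 0 < H) (h1 : H < 1) (hB : HasFractionalIncrements P H B)
    (hA : IsStable (companion p α)) {Y : ℝ → Ω → ℝ} :
    IsMovingAverage P B p q α β σ Y ↔ ∀ t, Y t =ᵐ[P] fun ω => -(α 0 / α 1)
      + σ * (incrementAverage (curveLp P B hB.memLp) (deriv (carfimaKernel p q α β)) t :
          Lp ℝ 2 P) ω := by
  refine forall_congr' fun t => ?_
  have hint (J : Ω → ℝ) := hB.isIntegralIic_iff h0 h1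
    (contDiff_one_impulseResponse (companion p α) (betaVec p q β) (deltaVec p))
    (hA.integrableOn_deriv_impulseResponse _ _) (hA.tendsto_one_add_abs_mul_impulseResponse _ _)
    t (J := J)
  constructor
  · rintro ⟨J, hJ, hY⟩
    filter_upwards [(hint J).1 hJ, hY] with ω hJω hYω
    rw [hYω, hJω]
    rfl
  · exact fun hY => ⟨_, (hint _).2 .rfl, hY⟩

theorem hasSpectralDensity_of_isMovingAverage [IsProbabilityMeasure P] (h0 : 0 < H) (h1 : H < 1)
    (hB : HasFractionalIncrements P H B) (hqp : q < p) (hA : IsStable (companion p α))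
    {Y : ℝ → Ω → ℝ} (hY : IsMovingAverage P B p q α β σ Y) :
    HasSpectralDensity P Y (carfimaDensity p q α β H σ) :=
  hB.hasSpectralDensity h0 h1 (hA.integrableOn_deriv_impulseResponse _ _)
    ((hB.isMovingAverage_iff h0 h1 hA).1 hY) (carfimaDensity_nonneg h0 h1)
    ((volume.ae_ne 0).mono fun _ hw => carfimaDensity_eq_of_ne_zero hqp hA hw)

theorem isMovingAverage_of_isStateSolution [IsProbabilityMeasure P] (h0 : 0 < H) (h1 : H < 1)
    (hB : HasFractionalIncrements P H B) (hqp : q < p) (hA : IsStable (companion p α))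
    (hσ : σ ≠ 0) {X : ℝ → Ω → Fin p → ℝ} (hX : IsStateSolution P B p α σ X)
    (hs : IsStrictlyStationary P X) :
    IsMovingAverage P B p q α β σ fun t ω => betaVec p q β ⬝ᵥ X t ω := by
  have hd : deltaVec p ≠ 0 := Function.ne_iff.2 ⟨⟨p - 1, by omega⟩, by simp [deltaVec]; omega⟩
  have hpath : ∀ᵐ ω ∂P, IsPathSolution (companion p α) (α 0 • deltaVec p) (deltaVec p)
      (fun t => σ * B t ω) fun t => X t ω :=
    hX.mono fun ω hω => ⟨hω.1, fun s t hst => by rw [hω.2 s t hst, mul_sub]⟩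
  have hmean : ∫ r in Set.Ioi (0 : ℝ), impulseResponse (companion p α) (betaVec p q β)
      (α 0 • deltaVec p) r = -(α 0 / α 1) := by
    simp only [impulseResponse, mulVec_smul, dotProduct_smul, smul_eq_mul, integral_const_mul]
    rw [← mul_one_div, ← mul_neg, ← integral_impulseResponse_companion hqp β hA]
    rfl
  rw [hB.isMovingAverage_iff h0 h1 hA, ← hmean]
  exact hB.dotProduct_ae_eq_incrementAverage h0 h1 hA hσ hd hpath hs (betaVec p q β)

end HasFractionalIncrements

end CarfimaProcess

end Carfima

end

open Carfima in
theorem theorem3_general {Ω : Type*} [MeasurableSpace Ω] (P : Measure Ω) [IsProbabilityMeasure P]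
    (p q : ℕ) (hqp : q < p) (α β : ℕ → ℝ) (σ : ℝ) (hσ : σ ≠ 0) (H : ℝ) (hH0 : 0 < H) (hH1 : H < 1)
    (hA : IsStable (companion p α)) (B : ℝ → Ω → ℝ) (hB : HasFractionalIncrements P H B) :
    (∃ Y : ℝ → Ω → ℝ, IsMovingAverage P B p q α β σ Y) ∧
    (∀ Y : ℝ → Ω → ℝ, IsMovingAverage P B p q α β σ Y →
      HasSpectralDensity P Y (carfimaDensity p q α β H σ)) ∧
    (∀ X : ℝ → Ω → Fin p → ℝ, IsStateSolution P B p α σ X → IsStrictlyStationary P X →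
      HasSpectralDensity P (fun t ω => betaVec p q β ⬝ᵥ X t ω) (carfimaDensity p q α β H σ)) ∧
    (∀ w : ℝ, carfimaDensity p q α β H σ w = armaDensity p q α β σ w *
      (Real.Gamma (2 * H + 1) * Real.sin (Real.pi * H) * |w| ^ (1 - 2 * H))) ∧
    (H < 1 / 2 → carfimaDensity p q α β H σ 0 = 0) := by
  refine ⟨⟨_, (hB.isMovingAverage_iff hH0 hH1 hA).2 fun t => .rfl⟩,
    fun Y => hB.hasSpectralDensity_of_isMovingAverage hH0 hH1 hqp hA, fun X hX hs => ?_,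
    fun w => ?_, fun hH => ?_⟩
  · exact hB.hasSpectralDensity_of_isMovingAverage hH0 hH1 hqp hA
      (hB.isMovingAverage_of_isStateSolution hH0 hH1 hqp hA hσ hX hs)
  · rw [carfimaDensity, armaDensity]
    ring
  · rw [carfimaDensity, abs_zero, Real.zero_rpow (by linarith), mul_zero, zero_mul]

theorem theorem3 {Ω : Type*} [MeasurableSpace Ω] (P : Measure Ω) [IsProbabilityMeasure P]
    (p q : ℕ) (hqp : q < p) (α β : ℕ → ℝ) (hα : α 1 ≠ 0) (hβ : q ≠ 0 → β q ≠ 0)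
    (σ : ℝ) (hσ : 0 < σ) (H : ℝ) (hH0 : 0 < H) (hH1 : H < 1)
    (hA : Carfima.IsStable (Carfima.companion p α))
    (B : ℝ → Ω → ℝ) (hB : Carfima.IsFBM P H B) :
    (∃ Y : ℝ → Ω → ℝ, Carfima.IsMovingAverage P B p q α β σ Y) ∧
    (∀ Y : ℝ → Ω → ℝ, Carfima.IsMovingAverage P B p q α β σ Y →
      Carfima.HasSpectralDensity P Y (Carfima.carfimaDensity p q α β H σ)) ∧
    (∀ X : ℝ → Ω → Fin p → ℝ, Carfima.IsStateSolution P B p α σ X →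
      Carfima.IsStrictlyStationary P X →
      Carfima.HasSpectralDensity P (fun t ω => Carfima.betaVec p q β ⬝ᵥ X t ω)
        (Carfima.carfimaDensity p q α β H σ)) ∧
    (∀ w : ℝ, Carfima.carfimaDensity p q α β H σ w =
      Carfima.armaDensity p q α β σ w *
        (Real.Gamma (2 * H + 1) * Real.sin (Real.pi * H) * |w| ^ (1 - 2 * H))) ∧
    (H < 1 / 2 → Carfima.carfimaDensity p q α β H σ 0 = 0) :=
  theorem3_general P p q hqp α β σ hσ.ne' H hH0 hH1 hA B (hB.hasFractionalIncrements hH0)
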